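/- Let $\mathcal H_1,\dots,\mathcal H_q$ be finitely many pairwise distinct hyperplanes of $\mathbb R^d$, any two of them parallel or orthogonal, and let $\Gamma=\bigcup_j\mathcal H_j$. Let $(\mathcal M_k)$ be the finite partition of $\mathbb R^d$ into the nonempty sets of points that have the same position (on it, or on the same open side) with respect to every $\mathcal H_j$. Those $\mathcal M_k$ that do not meet $\Gamma$ are the open cells $\Omega_i$ (the connected components of $\mathbb R^d\setminus\Gamma$); the others partition $\Gamma$. Let $T>0$, let $\mathcal A\subset\mathbb R^N$ be compact, let $f:\mathbb R^d\times\mathcal A\to\mathbb R^d$, $\ell:\mathbb R^d\times\mathcal A\to\mathbb R$, and put $F(x)=f(x,\mathcal A)$, $L(x)=\ell(x,\mathcal A)$. Assume, "locally Lipschitz" for set-valued maps being meant with respect to the Hausdorff distance: * **(HF)** $F$ has nonempty compact images and is upper semicontinuous; $F|_{\overline{\Omega}_i}$ is locally Lipschitz for each $i$; $|v|\le c_f(1+|x|)$ for all $v\in F(x)$, for some $c_f>0$. * **(HL)** $L$ has nonempty compact images and is upper semicontinuous; $L|_{\overline{\Omega}_i}$ is locally Lipschitz for each $i$; $0\le c\le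 c_l(1+|x|^{\lambda_l})$ for all $c\in L(x)$, for some $c_l>0$, $\lambda_l\ge1$. * **(HG)** the augmented dynamics $G(x)=\{(f(x,a),-\ell(x,a)-r): a\in\mathcal A,\ 0\le r\le c_l(1+|x|^{\lambda_l})-\ell(x,a)\}$ has convex images; moreover $G|_{\overline\Omega_i}$ is locally Lipschitz for each $i$. * **(H2)** there is $r_1>0$ with $B(0,r_1)\subset F(x)$ for all $x\in\Gamma$. For a closed set $C$ and $x\in C$ let $\mathcal T_C(x)=\{v:\liminf_{s\to0^+} d(x+sv,C)/s=0\}$. For $x\in\overline{\mathcal M_k}$ let $F_k^{\rm ext}(x)$ be the value at $x$ of the extension by continuity of $F|_{\mathcal M_k}$ to $\overline{\mathcal M_k}$, that is, the set of $v$ with $d(v,F(y))\to0$ as $y\to x$, $y\in\mathcal M_k$. Put $$A^E_{\mathcal M_k}(x)=\{a\in\mathcal A: f(x,a)\in F_k^{\rm ext}(x)\cap\mathcal T_{\overline{\mathcal M_k}}(x)\},\qquad A^E(x)=\bigcup_{k:\,x\in\overline{\mathcal M_k}}A^E_{\mathcal M_k}(x),$$ $$H^E(x,p)=\sup_{a\in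 A^E(x)}\{-p\cdot f(x,a)-\ell(x,a)\}\qquad(\sup\emptyset=-\infty).$$ A function $u:[0,T]\times\mathbb R^d\to\mathbb R$ is a viscosity solution of $$-\partial_tu+H^E(x,Du)=0\ \text{ in }(0,T)\times\mathbb R^d,\qquad u(T,\cdot)=\psi,\qquad\qquad(\ast)$$ if $u(T,\cdot)=\psi$ and the following two conditions hold. * Supersolution: $u$ is lower semicontinuous on $(0,T]\times\mathbb R^d$, and $-\phi_t(t_0,x_0)+H^E(x_0,D\phi(t_0,x_0))\ge0$ whenever $\phi\in C^1((0,T)\times\mathbb R^d)$ and $u-\phi$ has a local minimum at $(t_0,x_0)\in(0,T)\times\mathbb R^d$. * Subsolution: $u$ is upper semicontinuous on $(0,T]\times\mathbb R^d$, and for every $(t_0,x_0)\in(0,T)\times\mathbb R^d$, every $k$ with $x_0\in\overline{\mathcal M_k}$ and every continuous $\phi:(0,T)\times\mathbb R^d\to\mathbb R$ that is $C^1$ on $(0,T)\times\overline{\mathcal M_k}$ (its differential along $(0,T)\times\mathcal M_k$ exists and extends continuously to $(0,T)\times\overline{\mathcal M_k}$), if $u-\phi$ has a local maximum relative to $(0,T)\times\overline{\mathcal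 M_k}$ at $(t_0,x_0)$, then $$-p_t+\sup_{a\in A^E_{\mathcal M_k}(x_0)}\{-p_x\cdot f(x_0,a)-\ell(x_0,a)\}\le0,$$ where $(p_t,p_x)$ is the extended differential of $\phi$ at $(t_0,x_0)$. Let $f^n:\mathbb R^d\times\mathcal A\to\mathbb R^d$ and $\ell^n:\mathbb R^d\times\mathcal A\to\mathbb R$ satisfy (HF) and (HL) with constants (growth constants, exponent and local Lipschitz constants) independent of $n$, and let $f^n\to f$ and $\ell^n\to\ell$ locally uniformly on $\mathbb R^d\times\mathcal A$. Let $\varphi$ and $\varphi_n$ ($n\in\mathbb N$) be Lipschitz continuous functions on $\mathbb R^d$ with $\varphi_n\to\varphi$ locally uniformly. For each $n$, let $u_n$ be a viscosity solution of $(\ast)$ for the data $(f^n,\ell^n)$ with $\psi=\varphi_n$, such that the restriction of $u_n$ to $[0,T]\times\Gamma$ is locally Lipschitz continuous. **Theorem.** If $u_n\to u$ locally uniformly on $[0,T]\times\mathbb R^d$ and $u$ is continuous, then $u$ is a viscosity solution of $(\ast)$ for the data $(f,\ell)$ with $\psi=\varphi$. -/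

import Mathlib

open Filter Topology Set
open scoped NNReal ENNReal

noncomputable section

namespace HJB

/-- The state space `ℝ^d` with its Euclidean norm. -/
abbrev Pt (d : ℕ) := EuclideanSpace ℝ (Fin d)

/-- Finitely many pairwise distinct hyperplanes `{x | ⟨n_j, x⟩ = c_j}` of `ℝ^d`, any two of which are
parallel or orthogonal. As is always possible, parallel hyperplanes carry the same unit normal. -/
structure MultiDomain (d : ℕ) where
  q : ℕ
  normal : Fin q → Pt d
  offset : Fin q → ℝ
  norm_normal : ∀ j, ‖normal j‖ = 1
  parallel_or_perp : ∀ i j, normal i = normal j ∨ inner ℝ (normal i) (normal j) = 0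
  distinct : ∀ i j, normal i = normal j → offset i = offset j → i = j

namespace MultiDomain

variable {d : ℕ} (D : MultiDomain d)

/-- The hyperplane `ℋ_j`. -/
def hyperplane (j : Fin D.q) : Set (Pt d) := {x | inner ℝ (D.normal j) x = D.offset j}

/-- The interface `Γ = ⋃_j ℋ_j`. -/
def interface : Set (Pt d) := ⋃ j, D.hyperplane j

/-- The subdomains `ℳ_k` of the partition of `ℝ^d` induced by the hyperplanes: points that lie in the
same position (negative side, on it, positive side) with respect to each hyperplane. The index `k`
is the sign vector `σ`; only the nonempty sets matter. -/
def stratum (σ : Fin D.q → SignType) : Set (Pt d) :=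
  {x | ∀ j, SignType.sign (inner ℝ (D.normal j) x - D.offset j) = σ j}

/-- The sign vectors of the cells `Ω_i`, which lie on no hyperplane. All the other strata make up a
partition of `Γ` into the pieces `Γ_k`. -/
def IsCell (σ : Fin D.q → SignType) : Prop := ∀ j, σ j ≠ 0

theorem cell_disjoint_interface (σ : Fin D.q → SignType) (hσ : D.IsCell σ) :
    D.interface ∩ D.stratum σ = ∅ := by
  ext x
  simp only [interface, mem_inter_iff, mem_iUnion, mem_empty_iff_false, iff_false, not_and]
  rintro ⟨j, hj⟩ hx
  apply hσ j
  rw [← hx j, sign_eq_zero_iff, sub_eq_zero]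
  exact hj

theorem interface_union_cells :
    D.interface ∪ ⋃ σ ∈ {σ | D.IsCell σ}, D.stratum σ = univ := by
  ext x
  simp only [mem_univ, iff_true, mem_union, mem_iUnion, exists_prop, mem_ofPred_eq]
  by_cases h : x ∈ D.interface
  · exact Or.inl h
  · refine Or.inr ⟨fun j => SignType.sign (inner ℝ (D.normal j) x - D.offset j), ?_, fun j => rfl⟩
    intro j hj
    rw [sign_eq_zero_iff, sub_eq_zero] at hj
    exact h (mem_iUnion.2 ⟨j, hj⟩)

theorem isOpen_cell (σ : Fin D.q → SignType) (hσ : D.IsCell σ) : IsOpen (D.stratum σ) := by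
  have : D.stratum σ =
      ⋂ j, {x | SignType.sign (inner ℝ (D.normal j) x - D.offset j) = σ j} := by
    ext x; simp [stratum]
  rw [this]
  refine isOpen_iInter_of_finite fun j => ?_
  have h0 := hσ j
  rcases hs : σ j with _ | _ | _
  · exact absurd hs h0
  · have : {x : Pt d | SignType.sign (inner ℝ (D.normal j) x - D.offset j) = SignType.neg} =
        {x | inner ℝ (D.normal j) x < D.offset j} := by
      ext x; exact sign_eq_neg_one_iff.trans sub_neg
    rw [this]
    exact isOpen_lt (by fun_prop) (by fun_prop)
  · have : {x : Pt d | SignType.sign (inner ℝ (D.normal j) x - D.offset j) = SignType.pos} =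
        {x | D.offset j < inner ℝ (D.normal j) x} := by
      ext x; exact sign_eq_one_iff.trans sub_pos
    rw [this]
    exact isOpen_lt (by fun_prop) (by fun_prop)

theorem convex_stratum (σ : Fin D.q → SignType) : Convex ℝ (D.stratum σ) := by
  intro x hx y hy a b ha hb hab j
  have e : inner ℝ (D.normal j) (a • x + b • y) - D.offset j =
      a * (inner ℝ (D.normal j) x - D.offset j) + b * (inner ℝ (D.normal j) y - D.offset j) := by
    rw [inner_add_right, inner_smul_right, inner_smul_right]
    linear_combination D.offset j * hab
  have h1 := hx j
  have h2 := hy j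
  rw [e]
  generalize inner ℝ (D.normal j) x - D.offset j = s at *
  generalize inner ℝ (D.normal j) y - D.offset j = t at *
  rcases hs : σ j with _ | _ | _
  · rw [hs] at h1 h2
    have h1' : s = 0 := sign_eq_zero_iff.1 h1
    have h2' : t = 0 := sign_eq_zero_iff.1 h2
    rw [h1', h2']
    simp
  · rw [hs] at h1 h2
    have h1' : s < 0 := sign_eq_neg_one_iff.1 h1
    have h2' : t < 0 := sign_eq_neg_one_iff.1 h2
    refine sign_eq_neg_one_iff.2 ?_
    rcases ha.eq_or_lt with h | h
    · have : b = 1 := by linarith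
      subst h this; simpa using h2'
    · nlinarith
  · rw [hs] at h1 h2
    have h1' : 0 < s := sign_eq_one_iff.1 h1
    have h2' : 0 < t := sign_eq_one_iff.1 h2
    refine sign_eq_one_iff.2 ?_
    rcases ha.eq_or_lt with h | h
    · have : b = 1 := by linarith
      subst h this; simpa using h2'
    · nlinarith

end MultiDomain

/-- The (contingent) tangent cone `{v | liminf_{s → 0+} d_C(x + s v) / s = 0}`. -/
def tangentCone {d : ℕ} (C : Set (Pt d)) (x : Pt d) : Set (Pt d) :=
  {v | liminf (fun s : ℝ => Metric.infDist (x + s • v) C / s) (𝓝[>] 0) = 0}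

section Dynamics

variable {d N : ℕ}

/-- `F(x) = {f(x,a) : a ∈ 𝒜}`. -/
def dyn (𝒜 : Set (Pt N)) (f : Pt d → Pt N → Pt d) (x : Pt d) : Set (Pt d) := f x '' 𝒜

/-- `L(x) = {ℓ(x,a) : a ∈ 𝒜}`. -/
def costSet (𝒜 : Set (Pt N)) (ℓ : Pt d → Pt N → ℝ) (x : Pt d) : Set ℝ := ℓ x '' 𝒜

/-- The augmented dynamics
`G(x) = {(f(x,a), -ℓ(x,a) - r) : a ∈ 𝒜, 0 ≤ r ≤ c_l (1 + |x|^λ) - ℓ(x,a)}`. -/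
def augDyn (𝒜 : Set (Pt N)) (f : Pt d → Pt N → Pt d) (ℓ : Pt d → Pt N → ℝ) (cl lam : ℝ)
    (x : Pt d) : Set (Pt d × ℝ) :=
  {z | ∃ a ∈ 𝒜, ∃ r : ℝ, 0 ≤ r ∧ r ≤ cl * (1 + ‖x‖ ^ lam) - ℓ x a ∧ z = (f x a, -ℓ x a - r)}

/-- A set-valued map is locally Lipschitz on `S` for the Hausdorff distance: for each `R` it is
Lipschitz with constant `K R` on the part of `S` in the ball of radius `R`. -/
def LipschitzOnBalls {Y : Type*} [PseudoEMetricSpace Y] (K : ℝ → ℝ≥0) (S : Set (Pt d))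
    (Φ : Pt d → Set Y) : Prop :=
  ∀ R : ℝ, ∀ x ∈ S ∩ Metric.closedBall 0 R, ∀ y ∈ S ∩ Metric.closedBall 0 R,
    Metric.hausdorffEDist (Φ x) (Φ y) ≤ K R * edist x y

/-- Assumption (HF), with growth constant `cf` and local Lipschitz constants `K`. -/
structure HF (D : MultiDomain d) (𝒜 : Set (Pt N)) (f : Pt d → Pt N → Pt d)
    (cf : ℝ) (K : ℝ → ℝ≥0) : Prop where
  nonempty : ∀ x, (dyn 𝒜 f x).Nonempty
  compact : ∀ x, IsCompact (dyn 𝒜 f x)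
  usc : UpperHemicontinuous (dyn 𝒜 f)
  lipschitz : ∀ σ, D.IsCell σ → LipschitzOnBalls K (closure (D.stratum σ)) (dyn 𝒜 f)
  cf_pos : 0 < cf
  growth : ∀ x, ∀ v ∈ dyn 𝒜 f x, ‖v‖ ≤ cf * (1 + ‖x‖)

/-- Assumption (HL), with growth constants `cl`, `lam` and local Lipschitz constants `K`. -/
structure HL (D : MultiDomain d) (𝒜 : Set (Pt N)) (ℓ : Pt d → Pt N → ℝ)
    (cl lam : ℝ) (K : ℝ → ℝ≥0) : Prop where
  nonempty : ∀ x, (costSet 𝒜 ℓ x).Nonempty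
  compact : ∀ x, IsCompact (costSet 𝒜 ℓ x)
  usc : UpperHemicontinuous (costSet 𝒜 ℓ)
  lipschitz : ∀ σ, D.IsCell σ → LipschitzOnBalls K (closure (D.stratum σ)) (costSet 𝒜 ℓ)
  cl_pos : 0 < cl
  one_le_lam : 1 ≤ lam
  growth : ∀ x, ∀ c ∈ costSet 𝒜 ℓ x, 0 ≤ c ∧ c ≤ cl * (1 + ‖x‖ ^ lam)

/-- Assumption (HG): `G` has convex images. -/
def HG (𝒜 : Set (Pt N)) (f : Pt d → Pt N → Pt d) (ℓ : Pt d → Pt N → ℝ) (cl lam : ℝ) : Prop :=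
  ∀ x, Convex ℝ (augDyn 𝒜 f ℓ cl lam x)

/-- The augmented dynamics `G` is locally Lipschitz on the closure of each cell `Ω_i`. -/
def AugLipschitz (D : MultiDomain d) (𝒜 : Set (Pt N)) (f : Pt d → Pt N → Pt d)
    (ℓ : Pt d → Pt N → ℝ) (cl lam : ℝ) : Prop :=
  ∃ K : ℝ → ℝ≥0, ∀ σ, D.IsCell σ →
    LipschitzOnBalls K (closure (D.stratum σ)) (augDyn 𝒜 f ℓ cl lam)

/-- Assumption (H2): controllability on the interface. -/
def H2 (D : MultiDomain d) (𝒜 : Set (Pt N)) (f : Pt d → Pt N → Pt d) : Prop :=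
  ∃ r₁ : ℝ, 0 < r₁ ∧ ∀ x ∈ D.interface, Metric.ball 0 r₁ ⊆ dyn 𝒜 f x

/-- The extension by continuity `F_k^ext(x)`, `x ∈ closure M`, of `F` restricted to `M`: the set of
points whose distance to `F(y)` tends to `0` as `y → x` in `M`. -/
def dynExt (𝒜 : Set (Pt N)) (f : Pt d → Pt N → Pt d) (M : Set (Pt d)) (x : Pt d) : Set (Pt d) :=
  {v | Tendsto (fun y => Metric.infDist v (dyn 𝒜 f y)) (𝓝[M] x) (𝓝 0)}

/-- `F^E_M(x) = F_M^ext(x) ∩ T_{closure M}(x)`, for `x ∈ closure M`. -/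
def essDyn (𝒜 : Set (Pt N)) (f : Pt d → Pt N → Pt d) (M : Set (Pt d)) (x : Pt d) : Set (Pt d) :=
  dynExt 𝒜 f M x ∩ tangentCone (closure M) x

/-- `A^E_M(x) = {a ∈ 𝒜 : f(x,a) ∈ F^E_M(x)}`, for `x ∈ closure M`. -/
def essCtrlOn (𝒜 : Set (Pt N)) (f : Pt d → Pt N → Pt d) (M : Set (Pt d)) (x : Pt d) :
    Set (Pt N) :=
  {a | a ∈ 𝒜 ∧ f x a ∈ essDyn 𝒜 f M x}

/-- `A^E(x)`, the union of the `A^E_{ℳ_k}(x)` over the strata with `x ∈ closure ℳ_k`. -/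
def essCtrl (D : MultiDomain d) (𝒜 : Set (Pt N)) (f : Pt d → Pt N → Pt d) (x : Pt d) :
    Set (Pt N) :=
  {a | ∃ σ, x ∈ closure (D.stratum σ) ∧ a ∈ essCtrlOn 𝒜 f (D.stratum σ) x}

/-- `sup_{a ∈ S} {-p · f(x,a) - ℓ(x,a)}`, in the extended reals (`-∞` if `S` is empty), with the
vector `p` given as the linear form `v ↦ p · v`. -/
def hamSup (f : Pt d → Pt N → Pt d) (ℓ : Pt d → Pt N → ℝ) (S : Set (Pt N))
    (x : Pt d) (p : Pt d →L[ℝ] ℝ) : EReal :=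
  ⨆ a ∈ S, ((-p (f x a) - ℓ x a : ℝ) : EReal)

/-- The essential Hamiltonian `H^E`. -/
def hamE (D : MultiDomain d) (𝒜 : Set (Pt N)) (f : Pt d → Pt N → Pt d) (ℓ : Pt d → Pt N → ℝ)
    (x : Pt d) (p : Pt d →L[ℝ] ℝ) : EReal :=
  hamSup f ℓ (essCtrl D 𝒜 f x) x p

/-- Time component of a differential on `ℝ × ℝ^d`. -/
def timePart (δ : ℝ × Pt d →L[ℝ] ℝ) : ℝ := δ (1, 0)

/-- Space component of a differential on `ℝ × ℝ^d`. -/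
def spacePart (δ : ℝ × Pt d →L[ℝ] ℝ) : Pt d →L[ℝ] ℝ :=
  δ.comp (ContinuousLinearMap.inr ℝ ℝ (Pt d))

/-- Viscosity supersolution of `-∂_t u + H^E(x, Du) = 0`. -/
def IsSupersolution (D : MultiDomain d) (𝒜 : Set (Pt N)) (f : Pt d → Pt N → Pt d)
    (ℓ : Pt d → Pt N → ℝ) (T : ℝ) (u : ℝ × Pt d → ℝ) : Prop :=
  LowerSemicontinuousOn u (Ioc 0 T ×ˢ univ) ∧
  ∀ (t : ℝ) (x : Pt d), t ∈ Ioo 0 T →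
    ∀ φ : ℝ × Pt d → ℝ, ContDiffOn ℝ 1 φ (Ioo 0 T ×ˢ univ) →
      IsLocalMin (fun z => u z - φ z) (t, x) →
      0 ≤ ((-timePart (fderiv ℝ φ (t, x)) : ℝ) : EReal) +
        hamE D 𝒜 f ℓ x (spacePart (fderiv ℝ φ (t, x)))

/-- `φ` is `C¹` on `(0,T) × closure M` and `δ` is its extended differential: `δ z` is the differential
of `φ` along `(0,T) × M` at the points `z` of this set, and `δ` is continuous up to
`(0,T) × closure M`. For a relatively open convex `M`, only the values of `δ` in the directions of
the affine hull of `M` are determined by `φ`, and only those are used below. -/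
def HasExtDiff (T : ℝ) (M : Set (Pt d)) (φ : ℝ × Pt d → ℝ)
    (δ : ℝ × Pt d → (ℝ × Pt d →L[ℝ] ℝ)) : Prop :=
  ContinuousOn δ (Ioo 0 T ×ˢ closure M) ∧
  ∀ z ∈ Ioo 0 T ×ˢ M, HasFDerivWithinAt φ (δ z) (Ioo 0 T ×ˢ M) z

/-- Viscosity subsolution of `-∂_t u + H^E(x, Du) = 0`: on the closure of each stratum `ℳ_k`, the test
functions are continuous, and `C¹` on `(0,T) × closure ℳ_k`. -/
def IsSubsolution (D : MultiDomain d) (𝒜 : Set (Pt N)) (f : Pt d → Pt N → Pt d)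
    (ℓ : Pt d → Pt N → ℝ) (T : ℝ) (u : ℝ × Pt d → ℝ) : Prop :=
  UpperSemicontinuousOn u (Ioc 0 T ×ˢ univ) ∧
  ∀ (t : ℝ) (x : Pt d), t ∈ Ioo 0 T → ∀ σ, x ∈ closure (D.stratum σ) →
    ∀ (φ : ℝ × Pt d → ℝ) (δ : ℝ × Pt d → (ℝ × Pt d →L[ℝ] ℝ)),
      ContinuousOn φ (Ioo 0 T ×ˢ univ) → HasExtDiff T (D.stratum σ) φ δ →
      IsLocalMaxOn (fun z => u z - φ z) (Ioo 0 T ×ˢ closure (D.stratum σ)) (t, x) →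
      ((-timePart (δ (t, x)) : ℝ) : EReal) +
        hamSup f ℓ (essCtrlOn 𝒜 f (D.stratum σ) x) x (spacePart (δ (t, x))) ≤ 0

/-- Viscosity solution of `-∂_t u + H^E(x, Du) = 0` with final condition `u(T, ·) = ψ`. -/
def IsSolution (D : MultiDomain d) (𝒜 : Set (Pt N)) (f : Pt d → Pt N → Pt d)
    (ℓ : Pt d → Pt N → ℝ) (T : ℝ) (ψ : Pt d → ℝ) (u : ℝ × Pt d → ℝ) : Prop :=
  IsSupersolution D 𝒜 f ℓ T u ∧ IsSubsolution D 𝒜 f ℓ T u ∧ ∀ x, u (T, x) = ψ x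

end Dynamics

end HJB

end

open HJB

/-! The final condition passes to the limit pointwise. The supersolution part is classical. Since
`F` is continuous up to the boundary of each cell, and any velocity at a point is tangent to some
closed cell containing it, every control is essential (`HF.essCtrl_eq`). So `H^E` is an ordinary
supremum over `𝒜`, for the limit and for the approximations alike. A quadratic perturbation makes
the minimum strict, minimizers for `un n` converge to it, and controls are transferred to the limit
by `eventually_exists_control_of_tendsto`.

The subsolution part is delicate because tangency to a lower-dimensional stratum is unstable: a
control tangent to `σ` for `f` need not have a tangent counterpart for `fn n`. The remedy is to test
the approximate subsolutions on a full-dimensional cell `τ` adjacent to `σ`. The test function is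
composed with the orthogonal projection to the affine hull of `σ`, and `n` times the squared
distance to this hull is added. Maximizers over the closed cell converge to the original point
(`tendsto_of_isMaxOn_penalized`).

It remains to find an almost equally good control that is essential on `τ` at the maximizer and
along which the unbounded penalty gradient has a harmless sign. Convexity of `G` and controllability
on `Γ` allow a small change of velocity that points strictly to any chosen side of the hyperplanes
containing `σ` (`exists_control_strict_side`). Strict inequalities survive the passage to `fn n`. At
the maximizer the velocity is chosen inward for hyperplanes through that point, and towards the
hyperplane otherwise. -/

namespace HJB

/-! ### Geometry of the hyperplane arrangement and its closed cells. -/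

namespace MultiDomain

variable {d : ℕ} (D : MultiDomain d)

/-- The signed distance to the hyperplane `ℋ_j`. -/
noncomputable def gap (j : Fin D.q) (x : Pt d) : ℝ := inner ℝ (D.normal j) x - D.offset j

theorem continuous_gap (j : Fin D.q) : Continuous (D.gap j) := by
  unfold gap; fun_prop

theorem gap_add (j : Fin D.q) (x v : Pt d) :
    D.gap j (x + v) = D.gap j x + inner ℝ (D.normal j) v := by
  simp only [gap, inner_add_right]; ring

theorem gap_add_smul (j : Fin D.q) (x v : Pt d) (s : ℝ) :
    D.gap j (x + s • v) = D.gap j x + s * inner ℝ (D.normal j) v := by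
  rw [gap_add, inner_smul_right]

theorem mem_stratum {σ : Fin D.q → SignType} {x : Pt d} :
    x ∈ D.stratum σ ↔ ∀ j, SignType.sign (D.gap j x) = σ j := Iff.rfl

/-- Distinct parallel hyperplanes never meet, so those through a common point are mutually
orthogonal. This orthonormality underlies the explicit directions and the projection below. -/
theorem inner_normal_of_gap_eq_zero {x : Pt d} {i j : Fin D.q} (hi : D.gap i x = 0)
    (hj : D.gap j x = 0) : inner ℝ (D.normal i) (D.normal j) = if i = j then (1 : ℝ) else 0 := by
  split_ifs with h
  · subst h
    rw [real_inner_self_eq_norm_sq, D.norm_normal]; norm_num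
  · rcases D.parallel_or_perp i j with h' | h'
    · refine absurd (D.distinct i j h' ?_) h
      unfold gap at hi hj
      rw [h'] at hi
      linarith
    · exact h'

theorem inner_normal_sum {x : Pt d} {S : Finset (Fin D.q)} (hS : ∀ j ∈ S, D.gap j x = 0)
    (c : Fin D.q → ℝ) {i : Fin D.q} (hi : i ∈ S) :
    inner ℝ (D.normal i) (∑ j ∈ S, c j • D.normal j) = c i := by
  rw [inner_sum, Finset.sum_eq_single i]
  · rw [inner_smul_right, D.inner_normal_of_gap_eq_zero (hS i hi) (hS i hi)]; simp
  · intro j hj hji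
    rw [inner_smul_right, D.inner_normal_of_gap_eq_zero (hS i hi) (hS j hj), if_neg (Ne.symm hji),
      mul_zero]
  · exact fun h => absurd hi h

theorem sign_mul_gap_nonneg {σ : Fin D.q → SignType} {x : Pt d}
    (hx : x ∈ closure (D.stratum σ)) (j : Fin D.q) : 0 ≤ (σ j : ℝ) * D.gap j x := by
  have hc : IsClosed {x | 0 ≤ (σ j : ℝ) * D.gap j x} :=
    isClosed_le continuous_const (continuous_const.mul (D.continuous_gap j))
  refine closure_minimal (fun y hy => ?_) hc hx
  have := D.mem_stratum.1 hy j
  rw [mem_ofPred_eq, ← this, sign_mul_self]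
  exact abs_nonneg _

theorem gap_eq_zero_of_mem_closure {σ : Fin D.q → SignType} {x : Pt d}
    (hx : x ∈ closure (D.stratum σ)) {j : Fin D.q} (hj : σ j = 0) : D.gap j x = 0 := by
  have hc : IsClosed {x | D.gap j x = 0} := isClosed_eq (D.continuous_gap j) continuous_const
  refine closure_minimal (fun y hy => ?_) hc hx
  have := D.mem_stratum.1 hy j
  rwa [hj, sign_eq_zero_iff] at this

theorem sign_eq_of_cast_mul_pos {s : SignType} {r : ℝ} (h : 0 < (s : ℝ) * r) :
    SignType.sign r = s := by
  rcases s with _ | _ | _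
  · simp at h
  · exact sign_eq_neg_one_iff.2 (by simpa using h)
  · exact sign_eq_one_iff.2 (by simpa using h)

theorem cast_sign_mul_self {s : SignType} (h : s ≠ 0) : (s : ℝ) * s = 1 := by
  rcases s with _ | _ | _
  · exact absurd rfl h
  · simp
  · simp

theorem mem_closure_cell_iff {τ : Fin D.q → SignType} (hτ : D.IsCell τ) {x : Pt d} :
    x ∈ closure (D.stratum τ) ↔ ∀ j, 0 ≤ (τ j : ℝ) * D.gap j x := by
  refine ⟨D.sign_mul_gap_nonneg, fun h => ?_⟩
  classical
  set S : Finset (Fin D.q) := Finset.univ.filter fun j => D.gap j x = 0 with hS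
  -- By orthonormality `w` points strictly to the `τ` side of every hyperplane through `x`; the
  -- other gaps keep their sign for small displacements.
  set w : Pt d := ∑ j ∈ S, (τ j : ℝ) • D.normal j with hw
  have hlim : Tendsto (fun s : ℝ => x + s • w) (𝓝[>] 0) (𝓝 x) := by
    have : Tendsto (fun s : ℝ => x + s • w) (𝓝 0) (𝓝 (x + (0 : ℝ) • w)) :=
      Continuous.tendsto (by fun_prop) 0
    rw [zero_smul, add_zero] at this
    exact this.mono_left nhdsWithin_le_nhds
  refine mem_closure_of_tendsto hlim ?_
  have key : ∀ j, ∀ᶠ s : ℝ in 𝓝[>] 0, SignType.sign (D.gap j (x + s • w)) = τ j := by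
    intro j
    by_cases hj : D.gap j x = 0
    · filter_upwards [self_mem_nhdsWithin] with s hs
      apply sign_eq_of_cast_mul_pos
      rw [gap_add_smul, hj, hw, D.inner_normal_sum (x := x) (by simp [hS]) _ (by simp [hS, hj]),
        zero_add, mul_left_comm, cast_sign_mul_self (hτ j), mul_one]
      exact hs
    · have hpos : 0 < (τ j : ℝ) * D.gap j x := by
        refine lt_of_le_of_ne (h j) (Ne.symm (mul_ne_zero ?_ hj))
        intro h0
        have := cast_sign_mul_self (hτ j)
        rw [h0] at this; simp at this
      have := ((continuous_const (y := (τ j : ℝ))).mul (D.continuous_gap j)).tendsto x |>.comp hlim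
      filter_upwards [this.eventually (lt_mem_nhds hpos)] with s hs
      exact sign_eq_of_cast_mul_pos hs
  exact eventually_all.2 key

/-- A point near `x₀` lies in a closed cell containing `x₀`. -/
theorem eventually_exists_cell (x₀ : Pt d) :
    ∀ᶠ x in 𝓝 x₀, ∃ τ, D.IsCell τ ∧ x ∈ closure (D.stratum τ) ∧ x₀ ∈ closure (D.stratum τ) := by
  have h : ∀ j, ∀ᶠ x in 𝓝 x₀, D.gap j x₀ ≠ 0 →
      SignType.sign (D.gap j x) = SignType.sign (D.gap j x₀) := by
    intro j
    by_cases hj : D.gap j x₀ = 0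
    · exact Eventually.of_forall fun x hx => absurd hj hx
    · have hpos : 0 < (SignType.sign (D.gap j x₀) : ℝ) * D.gap j x₀ := by
        rw [sign_mul_self]; exact abs_pos.2 hj
      have := ((continuous_const (y := (SignType.sign (D.gap j x₀) : ℝ))).mul (D.continuous_gap j)).tendsto x₀
      filter_upwards [this.eventually (lt_mem_nhds hpos)] with x hx _
      exact sign_eq_of_cast_mul_pos hx
  filter_upwards [eventually_all.2 h] with x hx
  -- The cell is read off from `x`, not `x₀`: a gap that vanishes at `x` vanishes at `x₀` too, so
  -- either side may be chosen there.
  have hτ : D.IsCell fun j => if D.gap j x = 0 then 1 else SignType.sign (D.gap j x) := by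
    intro j
    by_cases hj : D.gap j x = 0
    · simp [hj]
    · simp [hj]
  refine ⟨_, hτ, (D.mem_closure_cell_iff hτ).2 fun j => ?_,
    (D.mem_closure_cell_iff hτ).2 fun j => ?_⟩
  · by_cases hj : D.gap j x = 0
    · simp [hj]
    · simp only [if_neg hj, sign_mul_self, abs_nonneg]
  · by_cases hj : D.gap j x₀ = 0
    · simp [hj]
    · have hx' := hx j hj
      have : D.gap j x ≠ 0 := by
        intro h0
        rw [h0, sign_zero, eq_comm, sign_eq_zero_iff] at hx'
        exact hj hx'
      simp only [if_neg this, hx', sign_mul_self, abs_nonneg]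

end MultiDomain

/-! ### Contingent tangent cones. -/

section TangentCone

variable {d : ℕ} {C : Set (Pt d)} {x v : Pt d}

theorem mem_tangentCone_of_eventually_mem (h : ∀ᶠ s : ℝ in 𝓝[>] 0, x + s • v ∈ C) :
    v ∈ tangentCone C x := by
  have : (fun s : ℝ => Metric.infDist (x + s • v) C / s) =ᶠ[𝓝[>] 0] fun _ => (0 : ℝ) := by
    filter_upwards [h] with s hs
    rw [Metric.infDist_zero_of_mem hs, zero_div]
  rw [tangentCone, mem_ofPred_eq, liminf_congr this, liminf_const]

/-- `C` lies in a half-space with `x` on its boundary. A direction leaving the half-space moves away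
from `C` at linear rate, which keeps the liminf positive. -/
theorem inner_nonneg_of_mem_tangentCone (hx : x ∈ C) {e : Pt d} (he : ‖e‖ ≤ 1)
    (hC : ∀ y ∈ C, inner ℝ e x ≤ inner ℝ e y) (hv : v ∈ tangentCone C x) :
    0 ≤ inner ℝ e v := by
  by_contra! hneg
  have hlow : ∀ᶠ s : ℝ in 𝓝[>] 0, -inner ℝ e v ≤ Metric.infDist (x + s • v) C / s := by
    filter_upwards [self_mem_nhdsWithin] with s hs
    have hs : 0 < s := hs
    rw [le_div_iff₀ hs]
    refine (Metric.le_infDist ⟨x, hx⟩).2 fun y hy => ?_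
    have h1 : inner ℝ e (y - (x + s • v)) ≤ ‖y - (x + s • v)‖ :=
      (real_inner_le_norm _ _).trans (mul_le_of_le_one_left (norm_nonneg _) he)
    rw [dist_comm, dist_eq_norm]
    rw [inner_sub_right, inner_add_right, inner_smul_right] at h1
    nlinarith [hC y hy]
  -- A real-valued liminf is only meaningful for bounded quotients; this supplies the bound.
  have hup : ∀ᶠ s : ℝ in 𝓝[>] 0, Metric.infDist (x + s • v) C / s ≤ ‖v‖ := by
    filter_upwards [self_mem_nhdsWithin] with s hs
    have hs : 0 < s := hs
    rw [div_le_iff₀ hs]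
    refine (Metric.infDist_le_dist_of_mem hx).trans ?_
    rw [dist_eq_norm, add_sub_cancel_left, norm_smul, Real.norm_of_nonneg hs.le, mul_comm]
  have := le_liminf_of_le
    (IsBoundedUnder.isCoboundedUnder_ge ⟨‖v‖, by simpa using hup⟩) hlow
  rw [show liminf _ _ = _ from hv] at this
  linarith

end TangentCone

/-! ### Tangent cones of strata and projection to their affine hulls. -/

namespace MultiDomain

variable {d : ℕ} (D : MultiDomain d)

theorem mem_tangentCone_closure_cell {τ : Fin D.q → SignType} (hτ : D.IsCell τ) {x v : Pt d}
    (hx : x ∈ closure (D.stratum τ))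
    (h : ∀ j, D.gap j x = 0 → 0 ≤ (τ j : ℝ) * inner ℝ (D.normal j) v) :
    v ∈ tangentCone (closure (D.stratum τ)) x := by
  apply mem_tangentCone_of_eventually_mem
  simp only [D.mem_closure_cell_iff hτ]
  refine eventually_all.2 fun j => ?_
  by_cases hj : D.gap j x = 0
  · filter_upwards [self_mem_nhdsWithin] with s hs
    rw [gap_add_smul, hj, zero_add, mul_left_comm]
    exact mul_nonneg (le_of_lt hs) (h j hj)
  · have hpos : 0 < (τ j : ℝ) * D.gap j x := by
      refine lt_of_le_of_ne (D.sign_mul_gap_nonneg hx j) (Ne.symm (mul_ne_zero ?_ hj))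
      intro h0
      have := cast_sign_mul_self (hτ j)
      rw [h0] at this; simp at this
    have hc : Continuous fun s : ℝ => (τ j : ℝ) * D.gap j (x + s • v) :=
      continuous_const.mul ((D.continuous_gap j).comp (by fun_prop))
    have hlim := (hc.tendsto 0).mono_left (nhdsWithin_le_nhds (s := Ioi 0))
    rw [zero_smul, add_zero] at hlim
    filter_upwards [hlim.eventually (lt_mem_nhds hpos)] with s hs
    exact hs.le

theorem exists_cell_mem_tangentCone (x v : Pt d) :
    ∃ τ, D.IsCell τ ∧ x ∈ closure (D.stratum τ) ∧ v ∈ tangentCone (closure (D.stratum τ)) x := by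
  -- On each hyperplane through `x`, the cell lies on the side towards which `v` points.
  set τ : Fin D.q → SignType := fun j =>
    if D.gap j x = 0 then (if (inner ℝ (D.normal j) v : ℝ) = 0 then 1 else
      SignType.sign (inner ℝ (D.normal j) v : ℝ)) else SignType.sign (D.gap j x) with hdef
  have hτ : D.IsCell τ := by
    intro j
    by_cases hj : D.gap j x = 0
    · by_cases hv : (inner ℝ (D.normal j) v : ℝ) = 0
      · simp [hdef, hj, hv]
      · simp [hdef, hj, hv]
    · simp [hdef, hj]
  have hx : x ∈ closure (D.stratum τ) := by
    refine (D.mem_closure_cell_iff hτ).2 fun j => ?_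
    by_cases hj : D.gap j x = 0
    · simp [hj]
    · simp only [hdef, if_neg hj, sign_mul_self, abs_nonneg]
  refine ⟨τ, hτ, hx, D.mem_tangentCone_closure_cell hτ hx fun j hj => ?_⟩
  by_cases hv : (inner ℝ (D.normal j) v : ℝ) = 0
  · simp [hv]
  · simp only [hdef, if_pos hj, if_neg hv, sign_mul_self, abs_nonneg]

theorem sign_mul_inner_nonneg_of_mem_tangentCone {σ : Fin D.q → SignType} {x v : Pt d}
    (hx : x ∈ closure (D.stratum σ)) (hv : v ∈ tangentCone (closure (D.stratum σ)) x)
    {j : Fin D.q} (hj : D.gap j x = 0) : 0 ≤ (σ j : ℝ) * inner ℝ (D.normal j) v := by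
  rw [← real_inner_smul_left]
  refine inner_nonneg_of_mem_tangentCone hx ?_ (fun y hy => ?_) hv
  · rw [norm_smul, D.norm_normal, mul_one]
    rcases σ j with _ | _ | _ <;> simp
  · have := D.sign_mul_gap_nonneg hy j
    unfold gap at this hj
    rw [real_inner_smul_left, real_inner_smul_left, sub_eq_zero.1 hj]
    linarith

theorem inner_eq_zero_of_mem_tangentCone {σ : Fin D.q → SignType} {x v : Pt d}
    (hx : x ∈ closure (D.stratum σ)) (hv : v ∈ tangentCone (closure (D.stratum σ)) x)
    {j : Fin D.q} (hj : σ j = 0) : inner ℝ (D.normal j) v = (0 : ℝ) := by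
  have hC : ∀ y ∈ closure (D.stratum σ), inner ℝ (D.normal j) y = D.offset j := fun y hy =>
    sub_eq_zero.1 (D.gap_eq_zero_of_mem_closure hy hj)
  apply le_antisymm
  · have := inner_nonneg_of_mem_tangentCone hx (e := -D.normal j)
      (by rw [norm_neg, D.norm_normal]) (fun y hy => by
        rw [inner_neg_left, inner_neg_left, hC y hy, hC x hx]) hv
    rw [inner_neg_left] at this
    linarith
  · exact inner_nonneg_of_mem_tangentCone hx (D.norm_normal j).le
      (fun y hy => by rw [hC y hy, hC x hx]) hv

/-- The sign vector of a cell whose closure contains the stratum `σ`. -/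
def cellSign (σ : Fin D.q → SignType) (j : Fin D.q) : SignType := if σ j = 0 then 1 else σ j

theorem isCell_cellSign (σ : Fin D.q → SignType) : D.IsCell (D.cellSign σ) := by
  intro j
  unfold cellSign
  split_ifs with h
  · exact one_ne_zero
  · exact h

theorem closure_stratum_subset_closure_cellSign (σ : Fin D.q → SignType) :
    closure (D.stratum σ) ⊆ closure (D.stratum (D.cellSign σ)) := by
  intro x hx
  refine (D.mem_closure_cell_iff (D.isCell_cellSign σ)).2 fun j => ?_
  by_cases h : σ j = 0
  · rw [D.gap_eq_zero_of_mem_closure hx h, mul_zero]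
  · simpa [cellSign, h] using D.sign_mul_gap_nonneg hx j

/-- The indices of the hyperplanes that contain the stratum `σ`. -/
def flat (σ : Fin D.q → SignType) : Finset (Fin D.q) := Finset.univ.filter fun j => σ j = 0

theorem mem_flat {σ : Fin D.q → SignType} {j : Fin D.q} : j ∈ D.flat σ ↔ σ j = 0 := by
  simp [flat]

/-- The linear part of the orthogonal projection to the affine hull of the stratum `σ`. -/
noncomputable def projLin (σ : Fin D.q → SignType) : Pt d →L[ℝ] Pt d :=
  ContinuousLinearMap.id ℝ (Pt d) -
    ∑ j ∈ D.flat σ, (innerSL ℝ (D.normal j)).smulRight (D.normal j)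

/-- The orthogonal projection to the affine hull of the stratum `σ`. -/
noncomputable def proj (σ : Fin D.q → SignType) (x : Pt d) : Pt d :=
  x - ∑ j ∈ D.flat σ, D.gap j x • D.normal j

theorem projLin_apply (σ : Fin D.q → SignType) (v : Pt d) :
    D.projLin σ v = v - ∑ j ∈ D.flat σ, (inner ℝ (D.normal j) v : ℝ) • D.normal j := by
  simp [projLin]

theorem proj_eq (σ : Fin D.q → SignType) (x : Pt d) :
    D.proj σ x = D.projLin σ x + ∑ j ∈ D.flat σ, D.offset j • D.normal j := by
  simp only [proj, projLin_apply, gap, sub_smul, Finset.sum_sub_distrib]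
  abel

theorem hasFDerivAt_proj (σ : Fin D.q → SignType) (x : Pt d) :
    HasFDerivAt (D.proj σ) (D.projLin σ) x := by
  rw [show D.proj σ = fun x => D.projLin σ x + ∑ j ∈ D.flat σ, D.offset j • D.normal j from
    funext (D.proj_eq σ)]
  exact (D.projLin σ).hasFDerivAt.add_const _

theorem continuous_proj (σ : Fin D.q → SignType) : Continuous (D.proj σ) :=
  continuous_iff_continuousAt.2 fun x => (D.hasFDerivAt_proj σ x).continuousAt

theorem proj_eq_self {σ : Fin D.q → SignType} {x : Pt d}
    (h : ∀ j ∈ D.flat σ, D.gap j x = 0) : D.proj σ x = x := by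
  rw [proj, Finset.sum_eq_zero fun j hj => by rw [h j hj, zero_smul], sub_zero]

theorem projLin_eq_self {σ : Fin D.q → SignType} {v : Pt d}
    (h : ∀ j ∈ D.flat σ, inner ℝ (D.normal j) v = (0 : ℝ)) : D.projLin σ v = v := by
  rw [projLin_apply, Finset.sum_eq_zero fun j hj => by rw [h j hj, zero_smul], sub_zero]

/-- A hyperplane not containing the stratum is either orthogonal to all those containing it, so that
projecting leaves its gap unchanged, or parallel to one of them, so that its gap is constant on the
affine hull. Nonemptiness makes the containing hyperplanes share a point. -/
theorem mapsTo_proj {σ : Fin D.q → SignType} (hne : (D.stratum σ).Nonempty) :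
    MapsTo (D.proj σ) (D.stratum (D.cellSign σ)) (D.stratum σ) := by
  obtain ⟨y, hy⟩ := hne
  intro x hx
  have hy0 : ∀ j ∈ D.flat σ, D.gap j y = 0 := fun j hj =>
    D.gap_eq_zero_of_mem_closure (subset_closure hy) (D.mem_flat.1 hj)
  have hgap : ∀ i, D.gap i (D.proj σ x) = D.gap i x -
      inner ℝ (D.normal i) (∑ j ∈ D.flat σ, D.gap j x • D.normal j) := by
    intro i
    simp only [proj, gap, inner_sub_right]; ring
  have hflat : ∀ i ∈ D.flat σ, D.gap i (D.proj σ x) = 0 := by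
    intro i hi
    rw [hgap, D.inner_normal_sum hy0 _ hi, sub_self]
  refine D.mem_stratum.2 fun i => ?_
  by_cases hi : σ i = 0
  · rw [hflat i (D.mem_flat.2 hi), hi, sign_zero]
  by_cases hpar : ∃ j ∈ D.flat σ, D.normal i = D.normal j
  · obtain ⟨j, hj, hij⟩ := hpar
    have h1 := hflat j hj
    have h2 := hy0 j hj
    rw [← D.mem_stratum.1 hy i]
    unfold gap at h1 h2 ⊢
    rw [hij, sub_eq_zero.1 h1, sub_eq_zero.1 h2]
  · push Not at hpar
    have : inner ℝ (D.normal i) (∑ j ∈ D.flat σ, D.gap j x • D.normal j) = (0 : ℝ) := by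
      rw [inner_sum]
      refine Finset.sum_eq_zero fun j hj => ?_
      rw [inner_smul_right, (D.parallel_or_perp i j).resolve_left (hpar j hj), mul_zero]
    rw [hgap, this, sub_zero, D.mem_stratum.1 hx i, cellSign, if_neg hi]

end MultiDomain

end HJB

namespace HJB

/-! ### Hamiltonian inequalities without extended reals. -/

section Hamiltonian

variable {d N : ℕ}

theorem coe_add_nonpos_iff (r : ℝ) (x : EReal) : (r : EReal) + x ≤ 0 ↔ x ≤ ((-r : ℝ) : EReal) := by
  induction x with
  | bot => simp
  | top => simp
  | coe y => norm_cast; constructor <;> intro h <;> linarith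

theorem nonneg_coe_add_iff (r : ℝ) (x : EReal) : 0 ≤ (r : EReal) + x ↔ ((-r : ℝ) : EReal) ≤ x := by
  induction x with
  | bot => simp
  | top => simp
  | coe y => norm_cast; constructor <;> intro h <;> linarith

theorem apply_one_prod (δ : ℝ × Pt d →L[ℝ] ℝ) (v : Pt d) :
    δ (1, v) = timePart δ + spacePart δ v := by
  simp [timePart, spacePart, ← map_add]

theorem add_hamSup_nonpos_iff (f : Pt d → Pt N → Pt d) (ℓ : Pt d → Pt N → ℝ) (S : Set (Pt N))
    (x : Pt d) (δ : ℝ × Pt d →L[ℝ] ℝ) :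
    ((-timePart δ : ℝ) : EReal) + hamSup f ℓ S x (spacePart δ) ≤ 0 ↔
      ∀ a ∈ S, -δ (1, f x a) - ℓ x a ≤ 0 := by
  rw [coe_add_nonpos_iff, hamSup, iSup₂_le_iff]
  refine forall₂_congr fun a _ => ?_
  rw [EReal.coe_le_coe_iff, apply_one_prod]
  constructor <;> intro h <;> linarith

theorem nonneg_add_hamSup_iff (f : Pt d → Pt N → Pt d) (ℓ : Pt d → Pt N → ℝ) (S : Set (Pt N))
    (x : Pt d) (δ : ℝ × Pt d →L[ℝ] ℝ) :
    0 ≤ ((-timePart δ : ℝ) : EReal) + hamSup f ℓ S x (spacePart δ) ↔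
      ∀ ε > 0, ∃ a ∈ S, -ε < -δ (1, f x a) - ℓ x a := by
  rw [nonneg_coe_add_iff]
  constructor
  · intro h ε hε
    have : ((timePart δ - ε : ℝ) : EReal) < hamSup f ℓ S x (spacePart δ) :=
      lt_of_lt_of_le (EReal.coe_lt_coe_iff.2 (by linarith)) h
    obtain ⟨a, ha⟩ := lt_iSup_iff.1 this
    obtain ⟨haS, ha⟩ := lt_iSup_iff.1 ha
    refine ⟨a, haS, ?_⟩
    rw [EReal.coe_lt_coe_iff] at ha
    rw [apply_one_prod]
    linarith
  · intro h
    refine le_of_forall_lt fun c hc => ?_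
    obtain ⟨r, hcr, hr⟩ := EReal.lt_iff_exists_real_btwn.1 hc
    rw [EReal.coe_lt_coe_iff] at hr
    obtain ⟨a, ha, h'⟩ := h (timePart δ - r) (by linarith)
    refine hcr.trans_le (le_iSup₂_of_le a ha (EReal.coe_le_coe_iff.2 ?_))
    rw [apply_one_prod] at h'
    linarith

/-- Joint continuity of `(δ, v) ↦ δ (1, v)`, uniformly for bounded `v`. -/
theorem exists_pos_abs_apply_sub_lt (δ₀ : ℝ × Pt d →L[ℝ] ℝ) (C : ℝ) {κ : ℝ} (hκ : 0 < κ) :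
    ∃ η > 0, η ≤ κ ∧ ∀ (δ : ℝ × Pt d →L[ℝ] ℝ) (v v' : Pt d), ‖δ - δ₀‖ < η → ‖v‖ ≤ C →
      ‖v' - v‖ < η → |δ (1, v') - δ₀ (1, v)| < κ := by
  have hM : 0 < 3 + |C| + ‖δ₀‖ := by positivity
  -- With `η ≤ 1` the error is at most `η * (1 + |C| + ‖δ₀‖)`; the constant 3 leaves room for a
  -- strict inequality.
  refine ⟨min (min 1 κ) (κ / (3 + |C| + ‖δ₀‖)), by positivity,
    (min_le_left _ _).trans (min_le_right _ _), fun δ v v' hδ hv hv' => ?_⟩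
  set η := min (min 1 κ) (κ / (3 + |C| + ‖δ₀‖)) with hη
  have h1 : η ≤ 1 := (min_le_left _ _).trans (min_le_left _ _)
  have h2 : η * (3 + |C| + ‖δ₀‖) ≤ κ := (le_div_iff₀ hM).1 (min_le_right _ _)
  have h0 : 0 < η := by positivity
  have e : δ (1, v') - δ₀ (1, v) = (δ - δ₀) (1, v') + δ₀ (0, v' - v) := by
    have : ((0 : ℝ), v' - v) = (1, v') - (1, v) := by simp
    rw [this, map_sub, sub_apply]; ring
  have hn : ‖v'‖ ≤ 1 + |C| := by
    have : ‖v'‖ ≤ ‖v' - v‖ + ‖v‖ := by simpa using norm_add_le (v' - v) v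
    linarith [le_abs_self C]
  have hb1 : ‖(δ - δ₀) (1, v')‖ ≤ η * (1 + |C|) := by
    refine (ContinuousLinearMap.le_opNorm _ _).trans ?_
    refine mul_le_mul hδ.le ?_ (norm_nonneg _) h0.le
    rw [Prod.norm_mk]
    exact max_le (by simp) hn
  have hb2 : ‖δ₀ (0, v' - v)‖ ≤ ‖δ₀‖ * η := by
    refine (ContinuousLinearMap.le_opNorm _ _).trans ?_
    refine mul_le_mul_of_nonneg_left ?_ (norm_nonneg _)
    rw [Prod.norm_mk]
    exact max_le (by simpa using h0.le) hv'.le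
  rw [e]
  calc |(δ - δ₀) (1, v') + δ₀ (0, v' - v)| ≤ ‖(δ - δ₀) (1, v')‖ + ‖δ₀ (0, v' - v)‖ :=
        abs_add_le _ _
    _ ≤ η * (1 + |C|) + ‖δ₀‖ * η := add_le_add hb1 hb2
    _ < κ := by nlinarith

end Hamiltonian

/-! ### Essential controls and their approximation. -/

section Controls

variable {d N : ℕ} {D : MultiDomain d} {𝒜 : Set (Pt N)} {f : Pt d → Pt N → Pt d}
  {ℓ : Pt d → Pt N → ℝ} {cf cl lam : ℝ} {K : ℝ → ℝ≥0}

theorem LipschitzOnBalls.eventually_hausdorffEDist_lt {Y : Type*} [PseudoEMetricSpace Y]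
    {S : Set (Pt d)} {Φ : Pt d → Set Y} (h : LipschitzOnBalls K S Φ) {x : Pt d} (hx : x ∈ S)
    {ε : ℝ≥0∞} (hε : 0 < ε) :
    ∀ᶠ y in 𝓝 x, y ∈ S → Metric.hausdorffEDist (Φ y) (Φ x) < ε := by
  have hlim : Tendsto (fun y => (K (‖x‖ + 1) : ℝ≥0∞) * edist y x) (𝓝 x) (𝓝 0) := by
    have h1 : Tendsto (fun y => edist y x) (𝓝 x) (𝓝 0) := tendsto_iff_edist_tendsto_0.1 tendsto_id
    simpa using ENNReal.Tendsto.const_mul h1 (Or.inr ENNReal.coe_ne_top)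
  filter_upwards [hlim.eventually (gt_mem_nhds hε), Metric.ball_mem_nhds x one_pos] with y hy hyb hyS
  refine (h (‖x‖ + 1) y ⟨hyS, ?_⟩ x ⟨hx, ?_⟩).trans_lt hy
  · rw [mem_closedBall_zero_iff]
    rw [mem_ball_iff_norm] at hyb
    have : ‖y‖ ≤ ‖x‖ + ‖y - x‖ := by simpa using norm_add_le x (y - x)
    linarith
  · rw [mem_closedBall_zero_iff]; linarith

theorem HF.mem_dynExt (hF : HF D 𝒜 f cf K) {τ : Fin D.q → SignType} (hτ : D.IsCell τ) {x : Pt d}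
    (hx : x ∈ closure (D.stratum τ)) {v : Pt d} (hv : v ∈ dyn 𝒜 f x) :
    v ∈ dynExt 𝒜 f (D.stratum τ) x := by
  refine Metric.tendsto_nhds.2 fun ε hε => ?_
  have h := (hF.lipschitz τ hτ).eventually_hausdorffEDist_lt hx (ENNReal.ofReal_pos.2 hε)
  filter_upwards [h.filter_mono nhdsWithin_le_nhds, self_mem_nhdsWithin] with y hy hyS
  have hy := hy (subset_closure hyS)
  rw [Metric.hausdorffEDist_comm] at hy
  obtain ⟨w, hw, hvw⟩ := Metric.exists_edist_lt_of_hausdorffEDist_lt hv hy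
  rw [Real.dist_0_eq_abs, abs_of_nonneg Metric.infDist_nonneg]
  refine (Metric.infDist_le_dist_of_mem hw).trans_lt ?_
  rwa [edist_dist, ENNReal.ofReal_lt_ofReal_iff hε] at hvw

theorem HF.mem_essCtrlOn_cell (hF : HF D 𝒜 f cf K) {τ : Fin D.q → SignType} (hτ : D.IsCell τ)
    {x : Pt d} (hx : x ∈ closure (D.stratum τ)) {a : Pt N} (ha : a ∈ 𝒜)
    (hv : ∀ j, D.gap j x = 0 → 0 ≤ (τ j : ℝ) * inner ℝ (D.normal j) (f x a)) :
    a ∈ essCtrlOn 𝒜 f (D.stratum τ) x :=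
  ⟨ha, hF.mem_dynExt hτ hx (mem_image_of_mem _ ha), D.mem_tangentCone_closure_cell hτ hx hv⟩

/-- As `F` is continuous up to the interface, every control is essential. -/
theorem HF.essCtrl_eq (hF : HF D 𝒜 f cf K) (x : Pt d) : essCtrl D 𝒜 f x = 𝒜 := by
  ext a
  refine ⟨fun ⟨_, _, h⟩ => h.1, fun ha => ?_⟩
  obtain ⟨τ, hτ, hx, hv⟩ := D.exists_cell_mem_tangentCone x (f x a)
  exact ⟨τ, hx, ha, hF.mem_dynExt hτ hx (mem_image_of_mem _ ha), hv⟩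

theorem HL.mem_augDyn (hL : HL D 𝒜 ℓ cl lam K) (x : Pt d) {a : Pt N} (ha : a ∈ 𝒜) :
    (f x a, -ℓ x a) ∈ augDyn 𝒜 f ℓ cl lam x :=
  ⟨a, ha, 0, le_rfl, sub_nonneg.2 (hL.growth x _ (mem_image_of_mem _ ha)).2, by simp⟩

/-- The slack `r ≥ 0` in `G` leaves only an upper bound on the new cost. This suffices, since a
smaller cost only raises the Hamiltonian. -/
theorem HL.exists_control_of_hausdorffEDist_lt (hL : HL D 𝒜 ℓ cl lam K) {x y : Pt d} {ε : ℝ}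
    (h : Metric.hausdorffEDist (augDyn 𝒜 f ℓ cl lam x) (augDyn 𝒜 f ℓ cl lam y) < ENNReal.ofReal ε)
    {a : Pt N} (ha : a ∈ 𝒜) : ∃ b ∈ 𝒜, ‖f y b - f x a‖ < ε ∧ ℓ y b < ℓ x a + ε := by
  have hε : 0 < ε := ENNReal.ofReal_pos.1 (pos_of_gt h)
  obtain ⟨z, ⟨b, hb, r, hr, _, rfl⟩, hlt⟩ :=
    Metric.exists_edist_lt_of_hausdorffEDist_lt (hL.mem_augDyn (f := f) x ha) h
  rw [edist_dist, ENNReal.ofReal_lt_ofReal_iff hε, Prod.dist_eq, max_lt_iff, dist_comm,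
    dist_eq_norm, Real.dist_eq] at hlt
  refine ⟨b, hb, hlt.1, ?_⟩
  have := (abs_lt.1 hlt.2).2
  dsimp only at this
  linarith

/-- `G` is controlled only on closed cells, but a nearby `x` shares one with `x₀`. It depends on
`x`, and finiteness of the set of cells gives a common neighbourhood. -/
theorem AugLipschitz.eventually_exists_control (hG : AugLipschitz D 𝒜 f ℓ cl lam)
    (hL : HL D 𝒜 ℓ cl lam K) (x₀ : Pt d) {ε : ℝ} (hε : 0 < ε) :
    ∀ᶠ x in 𝓝 x₀, (∀ a ∈ 𝒜, ∃ b ∈ 𝒜, ‖f x b - f x₀ a‖ < ε ∧ ℓ x b < ℓ x₀ a + ε) ∧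
      ∀ a ∈ 𝒜, ∃ b ∈ 𝒜, ‖f x₀ b - f x a‖ < ε ∧ ℓ x₀ b < ℓ x a + ε := by
  obtain ⟨KG, hKG⟩ := hG
  have h : ∀ᶠ x in 𝓝 x₀, ∀ τ, D.IsCell τ → x₀ ∈ closure (D.stratum τ) →
      x ∈ closure (D.stratum τ) → Metric.hausdorffEDist (augDyn 𝒜 f ℓ cl lam x)
        (augDyn 𝒜 f ℓ cl lam x₀) < ENNReal.ofReal ε := by
    refine eventually_all.2 fun τ => ?_
    by_cases hτ : D.IsCell τ ∧ x₀ ∈ closure (D.stratum τ)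
    · filter_upwards [(hKG τ hτ.1).eventually_hausdorffEDist_lt hτ.2
        (ENNReal.ofReal_pos.2 hε)] with x hx _ _ using hx
    · exact Eventually.of_forall fun x h1 h2 => absurd ⟨h1, h2⟩ hτ
  filter_upwards [h, D.eventually_exists_cell x₀] with x hx ⟨τ, hτ, hxτ, hx₀⟩
  have hd := hx τ hτ hx₀ hxτ
  refine ⟨fun a ha => hL.exists_control_of_hausdorffEDist_lt ?_ ha,
    fun a ha => hL.exists_control_of_hausdorffEDist_lt hd ha⟩
  rwa [Metric.hausdorffEDist_comm]

theorem eventually_forall_dist_lt_of_tendstoLocallyUniformlyOn {Y : Type*} [PseudoMetricSpace Y]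
    (h𝒜 : IsCompact 𝒜) {gn : ℕ → Pt d → Pt N → Y} {g : Pt d → Pt N → Y}
    (h : TendstoLocallyUniformlyOn (fun n (z : Pt d × Pt N) => gn n z.1 z.2)
      (fun z => g z.1 z.2) atTop (univ ×ˢ 𝒜)) {xn : ℕ → Pt d} {x₀ : Pt d}
    (hxn : Tendsto xn atTop (𝓝 x₀)) {ε : ℝ} (hε : 0 < ε) :
    ∀ᶠ n in atTop, ∀ a ∈ 𝒜, dist (g (xn n) a) (gn n (xn n) a) < ε := by
  have hc : IsCompact (Metric.closedBall x₀ 1 ×ˢ 𝒜) := (isCompact_closedBall x₀ 1).prod h𝒜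
  have hu := (tendstoLocallyUniformlyOn_iff_tendstoUniformlyOn_of_compact hc).1
    (h.mono (prod_mono_left (subset_univ _)))
  filter_upwards [Metric.tendstoUniformlyOn_iff.1 hu ε hε,
    hxn.eventually (Metric.closedBall_mem_nhds x₀ one_pos)] with n hn hx a ha
  exact hn (xn n, a) ⟨hx, ha⟩

theorem eventually_exists_control_of_tendsto (h𝒜 : IsCompact 𝒜)
    (hG : AugLipschitz D 𝒜 f ℓ cl lam) (hL : HL D 𝒜 ℓ cl lam K)
    {fn : ℕ → Pt d → Pt N → Pt d} {ℓn : ℕ → Pt d → Pt N → ℝ}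
    (hfn : TendstoLocallyUniformlyOn (fun n (z : Pt d × Pt N) => fn n z.1 z.2)
      (fun z => f z.1 z.2) atTop (univ ×ˢ 𝒜))
    (hℓn : TendstoLocallyUniformlyOn (fun n (z : Pt d × Pt N) => ℓn n z.1 z.2)
      (fun z => ℓ z.1 z.2) atTop (univ ×ˢ 𝒜))
    {xn : ℕ → Pt d} {x₀ : Pt d} (hxn : Tendsto xn atTop (𝓝 x₀)) {ε : ℝ} (hε : 0 < ε) :
    ∀ᶠ n in atTop,
      (∀ a ∈ 𝒜, ∃ b ∈ 𝒜, ‖fn n (xn n) b - f x₀ a‖ < ε ∧ ℓn n (xn n) b < ℓ x₀ a + ε) ∧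
      ∀ a ∈ 𝒜, ∃ b ∈ 𝒜, ‖f x₀ b - fn n (xn n) a‖ < ε ∧ ℓ x₀ b < ℓn n (xn n) a + ε := by
  filter_upwards [hxn.eventually (hG.eventually_exists_control hL x₀ (half_pos hε)),
    eventually_forall_dist_lt_of_tendstoLocallyUniformlyOn h𝒜 hfn hxn (half_pos hε),
    eventually_forall_dist_lt_of_tendstoLocallyUniformlyOn h𝒜 hℓn hxn (half_pos hε)]
    with n ⟨h1, h2⟩ hf hl
  simp only [dist_eq_norm] at hf hl
  refine ⟨fun a ha => ?_, fun a ha => ?_⟩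
  · obtain ⟨b, hb, hb1, hb2⟩ := h1 a ha
    refine ⟨b, hb, ?_, by linarith [(abs_lt.1 (hl b hb)).1]⟩
    have := norm_sub_le_norm_sub_add_norm_sub (fn n (xn n) b) (f (xn n) b) (f x₀ a)
    have := hf b hb
    rw [norm_sub_rev] at this
    linarith
  · obtain ⟨b, hb, hb1, hb2⟩ := h2 a ha
    refine ⟨b, hb, ?_, by linarith [(abs_lt.1 (hl a ha)).2]⟩
    have := norm_sub_le_norm_sub_add_norm_sub (f x₀ b) (f (xn n) a) (fn n (xn n) a)
    linarith [hf a ha]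

/-- By controllability on the interface and convexity of the augmented dynamics, a velocity can be
pushed strictly to a prescribed side of each hyperplane through `x`, at a small increase of the
cost. -/
theorem exists_control_strict_side (hL : HL D 𝒜 ℓ cl lam K) (hG : HG 𝒜 f ℓ cl lam)
    (h2 : H2 D 𝒜 f) {x : Pt d} {a : Pt N} (ha : a ∈ 𝒜) {s : Fin D.q → ℝ} (hs0 : ∀ j, s j ≠ 0)
    (hs : ∀ j, D.gap j x = 0 → 0 ≤ s j * inner ℝ (D.normal j) (f x a)) {ε : ℝ} (hε : 0 < ε) :
    ∃ b ∈ 𝒜, ‖f x b - f x a‖ < ε ∧ ℓ x b < ℓ x a + ε ∧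
      ∀ j, D.gap j x = 0 → 0 < s j * inner ℝ (D.normal j) (f x b) := by
  by_cases hx : ∀ j, D.gap j x ≠ 0
  · exact ⟨a, ha, by simpa using hε, by linarith, fun j hj => absurd hj (hx j)⟩
  push Not at hx
  obtain ⟨i, hi⟩ := hx
  obtain ⟨r₁, hr₁, hball⟩ := h2
  have hball := hball x (mem_iUnion.2 ⟨i, sub_eq_zero.1 hi⟩)
  set S : Finset (Fin D.q) := Finset.univ.filter fun j => D.gap j x = 0 with hS
  -- Here `⟨n_j, w₀⟩ = s j`, so `w₀` is strictly on the required side of each active hyperplane;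
  -- scaled by `η` it is an admissible velocity.
  set w₀ : Pt d := ∑ j ∈ S, s j • D.normal j with hw₀
  set η : ℝ := r₁ / (‖w₀‖ + 1) with hη
  have hηpos : 0 < η := by positivity
  have hw : η • w₀ ∈ Metric.ball (0 : Pt d) r₁ := by
    rw [mem_ball_zero_iff, norm_smul, Real.norm_of_nonneg hηpos.le, hη, div_mul_eq_mul_div,
      div_lt_iff₀ (by positivity)]
    nlinarith
  obtain ⟨b, hb, hbw⟩ := hball hw
  have hbw : f x b = η • w₀ := hbw
  have hθ : ∀ᶠ θ : ℝ in 𝓝[>] 0, θ < 1 ∧ ‖θ • (f x b - f x a)‖ < ε ∧ θ * (ℓ x b - ℓ x a) < ε := by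
    have l1 : Tendsto (fun θ : ℝ => ‖θ • (f x b - f x a)‖) (𝓝 0) (𝓝 0) := by
      have : Continuous fun θ : ℝ => ‖θ • (f x b - f x a)‖ := by fun_prop
      simpa using this.tendsto 0
    have l2 : Tendsto (fun θ : ℝ => θ * (ℓ x b - ℓ x a)) (𝓝 0) (𝓝 0) := by
      have : Continuous fun θ : ℝ => θ * (ℓ x b - ℓ x a) := by fun_prop
      simpa using this.tendsto 0
    refine Filter.Eventually.filter_mono nhdsWithin_le_nhds ?_
    exact (gt_mem_nhds one_pos).and
      ((l1.eventually (gt_mem_nhds hε)).and (l2.eventually (gt_mem_nhds hε)))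
  obtain ⟨θ, ⟨hθ1, hθf, hθl⟩, hθ0⟩ := (hθ.and self_mem_nhdsWithin).exists
  have hθ0 : 0 < θ := hθ0
  -- Mixing in a small fraction `θ` of the good velocity makes the weak inequalities strict. The
  -- slack `r` can only lower the cost of `c` below the convex combination.
  obtain ⟨c, hc, r, hr, _, hcr⟩ := hG x (hL.mem_augDyn (f := f) x ha) (hL.mem_augDyn (f := f) x hb)
    (sub_nonneg.2 hθ1.le) hθ0.le (sub_add_cancel 1 θ)
  simp only [Prod.smul_mk, Prod.mk_add_mk, smul_eq_mul, Prod.mk.injEq] at hcr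
  obtain ⟨hcf, hcl⟩ := hcr
  refine ⟨c, hc, ?_, by nlinarith, fun j hj => ?_⟩
  · rwa [← hcf, show (1 - θ) • f x a + θ • f x b - f x a = θ • (f x b - f x a) by module]
  · have hsj : 0 < s j * s j := mul_self_pos.2 (hs0 j)
    rw [← hcf, hbw, inner_add_right, inner_smul_right, inner_smul_right, inner_smul_right, hw₀,
      D.inner_normal_sum (x := x) (by simp [hS]) _ (by simp [hS, hj])]
    have h1 := mul_nonneg (sub_nonneg.2 hθ1.le) (hs j hj)
    have h2 : 0 < θ * η * (s j * s j) := by positivity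
    nlinarith

end Controls

/-! ### Convergence of penalized maximizers. -/

/-- Convergence of approximate maximizers of `wₙ - n q` to a point which is the only one of
`{q = 0}` at which `w = lim wₙ` is as large as at this point. -/
theorem tendsto_of_isMaxOn_penalized {E : Type*} [TopologicalSpace E] [FirstCountableTopology E]
    {B : Set E} (hB : IsCompact B) {w : E → ℝ} (hw : ContinuousOn w B) {wn : ℕ → E → ℝ}
    (hwn : TendstoUniformlyOn wn w atTop B) {q : E → ℝ} (hq : ContinuousOn q B)
    (hq0 : ∀ z ∈ B, 0 ≤ q z) {z₀ : E} (hz₀ : z₀ ∈ B)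
    (huniq : ∀ z ∈ B, q z = 0 → w z₀ ≤ w z → z = z₀) {zn : ℕ → E} (hzn : ∀ n, zn n ∈ B)
    (hmax : ∀ n, wn n z₀ ≤ wn n (zn n) - n * q (zn n)) : Tendsto zn atTop (𝓝 z₀) := by
  refine hB.tendsto_nhds_of_unique_mapClusterPt (Eventually.of_forall hzn) fun z hz hcl => ?_
  obtain ⟨ψ, hψ, hlim⟩ := hcl.tendsto_subseq
  have hlim' : Tendsto (zn ∘ ψ) atTop (𝓝[B] z) :=
    tendsto_nhdsWithin_iff.2 ⟨hlim, Eventually.of_forall fun n => hzn _⟩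
  have hqz : Tendsto (fun n => q (zn (ψ n))) atTop (𝓝 (q z)) := (hq z hz).tendsto.comp hlim'
  have hwz : Tendsto (fun n => w (zn (ψ n))) atTop (𝓝 (w z)) := (hw z hz).tendsto.comp hlim'
  have hwz₀ : Tendsto (fun n => wn (ψ n) z₀) atTop (𝓝 (w z₀)) :=
    (hwn.tendsto_at hz₀).comp hψ.tendsto_atTop
  have hwnz : Tendsto (fun n => wn (ψ n) (zn (ψ n))) atTop (𝓝 (w z)) := by
    have hd : Tendsto (fun n => wn (ψ n) (zn (ψ n)) - w (zn (ψ n))) atTop (𝓝 0) := by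
      refine Metric.tendsto_nhds.2 fun ε hε => ?_
      filter_upwards [hψ.tendsto_atTop.eventually (Metric.tendstoUniformlyOn_iff.1 hwn ε hε)]
        with n hn
      have := hn _ (hzn (ψ n))
      rw [dist_comm, Real.dist_eq] at this
      simpa [Real.dist_eq] using this
    simpa using hd.add hwz
  have hle : w z₀ ≤ w z := by
    refine le_of_tendsto_of_tendsto' hwz₀ hwnz fun n => ?_
    have : 0 ≤ (ψ n : ℝ) * q (zn (ψ n)) := mul_nonneg (Nat.cast_nonneg _) (hq0 _ (hzn _))
    linarith [hmax (ψ n)]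
  refine huniq z hz ?_ hle
  -- If `q z > 0`, the penalty along the subsequence tends to infinity, while the gain it must not
  -- exceed converges to `w z - w z₀`.
  by_contra hne
  have hpos : 0 < q z := lt_of_le_of_ne (hq0 z hz) (Ne.symm hne)
  have htop : Tendsto (fun n => (ψ n : ℝ) * q (zn (ψ n))) atTop atTop :=
    (tendsto_natCast_atTop_atTop.comp hψ.tendsto_atTop).atTop_mul_pos hpos hqz
  obtain ⟨n, h1, h2⟩ := ((htop.eventually_gt_atTop (w z - w z₀ + 1)).and
    ((hwnz.sub hwz₀).eventually (gt_mem_nhds (lt_add_one _)))).exists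
  linarith [hmax (ψ n)]

end HJB

namespace HJB

/-! ### Quadratic perturbation and penalty. -/

section Penalty

variable {d : ℕ}

/-- The squared distance to `z₀` in `ℝ × ℝ^d`. -/
noncomputable def sqDist (z₀ z : ℝ × Pt d) : ℝ := (z.1 - z₀.1) ^ 2 + ‖z.2 - z₀.2‖ ^ 2

theorem contDiff_sqDist (z₀ : ℝ × Pt d) : ContDiff ℝ 1 (sqDist z₀) := by
  unfold sqDist
  exact ((contDiff_fst.sub contDiff_const).pow 2).add ((contDiff_snd.sub contDiff_const).norm_sq ℝ)

theorem sqDist_nonneg (z₀ z : ℝ × Pt d) : 0 ≤ sqDist z₀ z := by unfold sqDist; positivity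

theorem sqDist_self (z₀ : ℝ × Pt d) : sqDist z₀ z₀ = 0 := by simp [sqDist]

theorem eq_of_sqDist_nonpos {z₀ z : ℝ × Pt d} (h : sqDist z₀ z ≤ 0) : z = z₀ := by
  unfold sqDist at h
  have h1 : (z.1 - z₀.1) ^ 2 = 0 := by nlinarith [sq_nonneg (z.1 - z₀.1), sq_nonneg ‖z.2 - z₀.2‖]
  have h2 : ‖z.2 - z₀.2‖ ^ 2 = 0 := by nlinarith [sq_nonneg (z.1 - z₀.1), sq_nonneg ‖z.2 - z₀.2‖]
  refine Prod.ext (sub_eq_zero.1 (pow_eq_zero_iff two_ne_zero |>.1 h1)) ?_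
  exact sub_eq_zero.1 (norm_eq_zero.1 (pow_eq_zero_iff two_ne_zero |>.1 h2))

theorem fderiv_sqDist_self (z₀ : ℝ × Pt d) : fderiv ℝ (sqDist z₀) z₀ = 0 :=
  IsLocalMin.fderiv_eq_zero <| Eventually.of_forall fun z => by
    rw [sqDist_self]; exact sqDist_nonneg z₀ z

variable (D : MultiDomain d)

/-- The squared distance to the affine hull of the stratum `σ`. -/
noncomputable def flatPenalty (σ : Fin D.q → SignType) (z : ℝ × Pt d) : ℝ :=
  ∑ j ∈ D.flat σ, D.gap j z.2 ^ 2

/-- The differential of `flatPenalty`. -/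
noncomputable def flatPenaltyDeriv (σ : Fin D.q → SignType) (z : ℝ × Pt d) :
    ℝ × Pt d →L[ℝ] ℝ :=
  ∑ j ∈ D.flat σ, (2 * D.gap j z.2) •
    (innerSL ℝ (D.normal j)).comp (ContinuousLinearMap.snd ℝ ℝ (Pt d))

theorem continuous_flatPenalty (σ : Fin D.q → SignType) : Continuous (flatPenalty D σ) :=
  continuous_finsetSum _ fun j _ => ((D.continuous_gap j).comp continuous_snd).pow 2

theorem continuous_flatPenaltyDeriv (σ : Fin D.q → SignType) :
    Continuous (flatPenaltyDeriv D σ) :=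
  continuous_finsetSum _ fun j _ =>
    (continuous_const.mul ((D.continuous_gap j).comp continuous_snd)).smul continuous_const

theorem hasFDerivAt_flatPenalty (σ : Fin D.q → SignType) (z : ℝ × Pt d) :
    HasFDerivAt (flatPenalty D σ) (flatPenaltyDeriv D σ z) z := by
  unfold flatPenalty flatPenaltyDeriv
  refine HasFDerivAt.fun_sum fun j _ => ?_
  have h : HasFDerivAt (fun z : ℝ × Pt d => D.gap j z.2)
      ((innerSL ℝ (D.normal j)).comp (ContinuousLinearMap.snd ℝ ℝ (Pt d))) z :=
    (((innerSL ℝ (D.normal j)).comp (ContinuousLinearMap.snd ℝ ℝ (Pt d))).hasFDerivAt).sub_const _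
  simpa using h.pow 2

theorem flatPenaltyDeriv_apply (σ : Fin D.q → SignType) (z : ℝ × Pt d) (r : ℝ) (v : Pt d) :
    flatPenaltyDeriv D σ z (r, v) =
      ∑ j ∈ D.flat σ, 2 * D.gap j z.2 * inner ℝ (D.normal j) v := by
  simp [flatPenaltyDeriv]

theorem flatPenalty_nonneg (σ : Fin D.q → SignType) (z : ℝ × Pt d) : 0 ≤ flatPenalty D σ z :=
  Finset.sum_nonneg fun _ _ => sq_nonneg _

theorem flatPenalty_eq_zero_iff {σ : Fin D.q → SignType} {z : ℝ × Pt d} :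
    flatPenalty D σ z = 0 ↔ ∀ j ∈ D.flat σ, D.gap j z.2 = 0 := by
  rw [flatPenalty, Finset.sum_eq_zero_iff_of_nonneg fun _ _ => sq_nonneg _]
  exact forall₂_congr fun j _ => pow_eq_zero_iff two_ne_zero

end Penalty

/-! ### Extension of test functions from a stratum to an adjacent cell. -/

section Extension

variable {d : ℕ} {D : MultiDomain d} {σ : Fin D.q → SignType} {T : ℝ} {φ : ℝ × Pt d → ℝ}
  {δ : ℝ × Pt d → (ℝ × Pt d →L[ℝ] ℝ)}

/-- The projection `(t, x) ↦ (t, P x)` to the affine hull of `ℝ × ℳ_σ`. -/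
noncomputable def timeProj (D : MultiDomain d) (σ : Fin D.q → SignType) (z : ℝ × Pt d) :
    ℝ × Pt d := (z.1, D.proj σ z.2)

/-- The linear part of `timeProj`. -/
noncomputable def timeProjLin (D : MultiDomain d) (σ : Fin D.q → SignType) :
    ℝ × Pt d →L[ℝ] ℝ × Pt d :=
  (ContinuousLinearMap.fst ℝ ℝ (Pt d)).prod
    ((D.projLin σ).comp (ContinuousLinearMap.snd ℝ ℝ (Pt d)))

theorem continuous_timeProj : Continuous (timeProj D σ) :=
  continuous_fst.prodMk ((D.continuous_proj σ).comp continuous_snd)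

theorem hasFDerivAt_timeProj (z : ℝ × Pt d) :
    HasFDerivAt (timeProj D σ) (timeProjLin D σ) z :=
  hasFDerivAt_fst.prodMk ((D.hasFDerivAt_proj σ z.2).comp z hasFDerivAt_snd)

theorem mapsTo_timeProj (hne : (D.stratum σ).Nonempty) (I : Set ℝ) :
    MapsTo (timeProj D σ) (I ×ˢ D.stratum (D.cellSign σ)) (I ×ˢ D.stratum σ) :=
  fun _ hz => ⟨hz.1, D.mapsTo_proj hne hz.2⟩

theorem mapsTo_timeProj_closure (hne : (D.stratum σ).Nonempty) (I : Set ℝ) :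
    MapsTo (timeProj D σ) (I ×ˢ closure (D.stratum (D.cellSign σ)))
      (I ×ˢ closure (D.stratum σ)) :=
  fun _ hz => ⟨hz.1, (D.mapsTo_proj hne).closure (D.continuous_proj σ) hz.2⟩

/-- The projection carries the cell into the stratum and closure into closure, so the chain rule
holds up to the boundary. Composing with `timeProjLin` also discards the normal values of `δ`, which
`φ` does not determine. -/
theorem HasExtDiff.comp_timeProj (h : HasExtDiff T (D.stratum σ) φ δ)
    (hne : (D.stratum σ).Nonempty) :
    HasExtDiff T (D.stratum (D.cellSign σ)) (fun z => φ (timeProj D σ z))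
      (fun z => (δ (timeProj D σ z)).comp (timeProjLin D σ)) :=
  ⟨(h.1.comp continuous_timeProj.continuousOn (mapsTo_timeProj_closure hne _)).clm_comp
      continuousOn_const,
    fun z hz => (h.2 _ (mapsTo_timeProj hne _ hz)).comp z
      (hasFDerivAt_timeProj z).hasFDerivWithinAt (mapsTo_timeProj hne _)⟩

theorem HasExtDiff.add_smooth {M : Set (Pt d)} (h : HasExtDiff T M φ δ) {g : ℝ × Pt d → ℝ}
    {g' : ℝ × Pt d → (ℝ × Pt d →L[ℝ] ℝ)} (hg : ∀ z, HasFDerivAt g (g' z) z)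
    (hg' : Continuous g') : HasExtDiff T M (fun z => φ z + g z) (fun z => δ z + g' z) :=
  ⟨h.1.add hg'.continuousOn, fun z hz => (h.2 z hz).add (hg z).hasFDerivWithinAt⟩

end Extension

/-! ### Stability of supersolutions and subsolutions. -/

section Stability

variable {d N : ℕ} {D : MultiDomain d} {𝒜 : Set (Pt N)} {f : Pt d → Pt N → Pt d}
  {ℓ : Pt d → Pt N → ℝ} {T cf cl lam cf' : ℝ} {KF KL KF' : ℝ → ℝ≥0}
  {fn : ℕ → Pt d → Pt N → Pt d} {ℓn : ℕ → Pt d → Pt N → ℝ}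
  {un : ℕ → ℝ × Pt d → ℝ} {u : ℝ × Pt d → ℝ}

theorem exists_closedBall_subset_strip {t : ℝ} (ht : t ∈ Ioo 0 T) (x : Pt d)
    {p : ℝ × Pt d → Prop} (hp : ∀ᶠ z in 𝓝 (t, x), p z) :
    ∃ r > 0, ∀ z ∈ Metric.closedBall (t, x) r, z.1 ∈ Ioo 0 T ∧ p z := by
  have h : ∀ᶠ z in 𝓝 (t, x), z.1 ∈ Ioo 0 T ∧ p z :=
    (continuous_fst.tendsto (t, x) |>.eventually (isOpen_Ioo.mem_nhds ht)).and hp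
  exact Metric.nhds_basis_closedBall.mem_iff.1 h

theorem isSupersolution_of_tendsto (h𝒜 : IsCompact 𝒜) (hF : HF D 𝒜 f cf KF)
    (hL : HL D 𝒜 ℓ cl lam KL) (hGLip : AugLipschitz D 𝒜 f ℓ cl lam)
    (hfn : TendstoLocallyUniformlyOn (fun n (z : Pt d × Pt N) => fn n z.1 z.2)
      (fun z => f z.1 z.2) atTop (univ ×ˢ 𝒜))
    (hℓn : TendstoLocallyUniformlyOn (fun n (z : Pt d × Pt N) => ℓn n z.1 z.2)
      (fun z => ℓ z.1 z.2) atTop (univ ×ˢ 𝒜))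
    (hFn : ∀ n, HF D 𝒜 (fn n) cf' KF')
    (hun : ∀ n, IsSupersolution D 𝒜 (fn n) (ℓn n) T (un n))
    (hulim : TendstoLocallyUniformlyOn un u atTop (Icc 0 T ×ˢ univ))
    (hu : ContinuousOn u (Icc 0 T ×ˢ univ)) : IsSupersolution D 𝒜 f ℓ T u := by
  refine ⟨(hu.mono (prod_mono_left Ioc_subset_Icc_self)).lowerSemicontinuousOn,
    fun t x ht φ hφ hmin => ?_⟩
  have hUo : IsOpen (Ioo 0 T ×ˢ (univ : Set (Pt d))) := isOpen_Ioo.prod isOpen_univ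
  set z₀ : ℝ × Pt d := (t, x) with hz₀
  -- The minimum of `u - ψ` is strict, and the differential at `z₀` is unchanged.
  set ψ : ℝ × Pt d → ℝ := fun z => φ z - sqDist z₀ z with hψdef
  have hψ : ContDiffOn ℝ 1 ψ (Ioo 0 T ×ˢ univ) := hφ.sub (contDiff_sqDist z₀).contDiffOn
  have hz₀U : z₀ ∈ Ioo 0 T ×ˢ (univ : Set (Pt d)) := ⟨ht, mem_univ _⟩
  have hDψ : fderiv ℝ ψ z₀ = fderiv ℝ φ z₀ := by
    have h1 := (hφ.contDiffAt (hUo.mem_nhds hz₀U)).differentiableAt one_ne_zero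
    have h2 := (contDiff_sqDist z₀).contDiffAt (x := z₀) |>.differentiableAt one_ne_zero
    rw [hψdef, fderiv_fun_sub h1 h2, fderiv_sqDist_self, sub_zero]
  obtain ⟨r, hr, hball⟩ := exists_closedBall_subset_strip ht x hmin
  have hBU : Metric.closedBall z₀ r ⊆ Ioo 0 T ×ˢ univ := fun z hz => ⟨(hball z hz).1, mem_univ _⟩
  have hBI : Metric.closedBall z₀ r ⊆ Icc 0 T ×ˢ univ :=
    hBU.trans (prod_mono_left Ioo_subset_Icc_self)
  have hBc : IsCompact (Metric.closedBall z₀ r) := isCompact_closedBall z₀ r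
  have hz₀B : z₀ ∈ Metric.closedBall z₀ r := Metric.mem_closedBall_self hr.le
  have hψB : ContinuousOn ψ (Metric.closedBall z₀ r) := hψ.continuousOn.mono hBU
  have hex : ∀ n, ∃ z ∈ Metric.closedBall z₀ r,
      IsMinOn (fun z => un n z + -ψ z) (Metric.closedBall z₀ r) z := fun n =>
    LowerSemicontinuousOn.exists_isMinOn ⟨z₀, hz₀B⟩ hBc
      (((hun n).1.mono (hBU.trans (prod_mono_left Ioo_subset_Ioc_self))).add
        hψB.neg.lowerSemicontinuousOn)
  choose zn hznB hzn using hex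
  have hunif := (tendstoLocallyUniformlyOn_iff_tendstoUniformlyOn_of_compact hBc).1
    (hulim.mono hBI)
  have hznlim : Tendsto zn atTop (𝓝 z₀) := by
    refine tendsto_of_isMaxOn_penalized hBc (w := fun z => ψ z - u z)
      (wn := fun n z => ψ z - un n z) (q := fun _ => 0) (hψB.sub (hu.mono hBI)) ?_
      continuousOn_const (fun _ _ => le_rfl) hz₀B (fun z hz _ hle => ?_) hznB fun n => ?_
    · refine Metric.tendstoUniformlyOn_iff.2 fun ε hε => ?_
      filter_upwards [Metric.tendstoUniformlyOn_iff.1 hunif ε hε] with n hn z hz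
      rw [dist_sub_left]; exact hn z hz
    · apply eq_of_sqDist_nonpos
      have h1 : u z₀ - φ z₀ ≤ u z - φ z := (hball z hz).2
      have h2 : φ z₀ - sqDist z₀ z₀ - u z₀ ≤ φ z - sqDist z₀ z - u z := hle
      rw [sqDist_self] at h2
      linarith
    · have : un n (zn n) + -ψ (zn n) ≤ un n z₀ + -ψ z₀ := hzn n hz₀B
      linarith
  have hDlim : Tendsto (fun n => fderiv ℝ ψ (zn n)) atTop (𝓝 (fderiv ℝ ψ z₀)) :=
    ((hψ.continuousOn_fderiv_of_isOpen hUo le_rfl).continuousAt (hUo.mem_nhds hz₀U)).tendsto.comp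
      hznlim
  have hxlim : Tendsto (fun n => (zn n).2) atTop (𝓝 x) := (continuous_snd.tendsto z₀).comp hznlim
  rw [hamE, hF.essCtrl_eq, nonneg_add_hamSup_iff]
  intro ε hε
  -- Three errors of at most `ε / 4` occur: near-optimality of `b`, the cost, and the differential
  -- applied to the velocity.
  obtain ⟨η, hη0, hηε, hη⟩ := exists_pos_abs_apply_sub_lt (fderiv ℝ ψ z₀) (cf * (1 + ‖x‖))
    (κ := ε / 4) (by positivity)
  obtain ⟨n, hnb, hnD, -, hnc⟩ := ((hznlim.eventually (Metric.ball_mem_nhds z₀ hr)).and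
    ((Metric.tendsto_nhds.1 hDlim η hη0).and
      (eventually_exists_control_of_tendsto h𝒜 hGLip hL hfn hℓn hxlim hη0))).exists
  have hloc : IsLocalMin (fun z => un n z - ψ z) (zn n) := by
    filter_upwards [Metric.isOpen_ball.mem_nhds hnb] with z hz
    have : un n (zn n) + -ψ (zn n) ≤ un n z + -ψ z := hzn n (Metric.ball_subset_closedBall hz)
    linarith
  have hsup := (hun n).2 (zn n).1 (zn n).2 (hBU (hznB n)).1 ψ hψ hloc
  rw [hamE, (hFn n).essCtrl_eq, nonneg_add_hamSup_iff] at hsup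
  obtain ⟨b, hb, hbv⟩ := hsup η hη0
  obtain ⟨a, ha, hab, hal⟩ := hnc b hb
  refine ⟨a, ha, ?_⟩
  rw [norm_sub_rev] at hab
  rw [dist_eq_norm] at hnD
  have := abs_lt.1 (hη _ _ _ hnD (hF.growth x _ (mem_image_of_mem _ ha)) hab)
  rw [hDψ] at this
  simp only [Prod.mk.eta] at hbv
  linarith

theorem isSubsolution_of_tendsto (h𝒜 : IsCompact 𝒜)
    (hL : HL D 𝒜 ℓ cl lam KL) (hG : HG 𝒜 f ℓ cl lam) (hGLip : AugLipschitz D 𝒜 f ℓ cl lam)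
    (h2 : H2 D 𝒜 f)
    (hfn : TendstoLocallyUniformlyOn (fun n (z : Pt d × Pt N) => fn n z.1 z.2)
      (fun z => f z.1 z.2) atTop (univ ×ˢ 𝒜))
    (hℓn : TendstoLocallyUniformlyOn (fun n (z : Pt d × Pt N) => ℓn n z.1 z.2)
      (fun z => ℓ z.1 z.2) atTop (univ ×ˢ 𝒜))
    (hFn : ∀ n, HF D 𝒜 (fn n) cf' KF')
    (hun : ∀ n, IsSubsolution D 𝒜 (fn n) (ℓn n) T (un n))
    (hulim : TendstoLocallyUniformlyOn un u atTop (Icc 0 T ×ˢ univ))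
    (hu : ContinuousOn u (Icc 0 T ×ˢ univ)) : IsSubsolution D 𝒜 f ℓ T u := by
  refine ⟨(hu.mono (prod_mono_left Ioc_subset_Icc_self)).upperSemicontinuousOn,
    fun t x ht σ hxσ φ δ hφ hδ hmax => ?_⟩
  have hne : (D.stratum σ).Nonempty := closure_nonempty_iff.1 ⟨x, hxσ⟩
  set τ := D.cellSign σ with hτdef
  have hτ : D.IsCell τ := D.isCell_cellSign σ
  have hxτ : x ∈ closure (D.stratum τ) := D.closure_stratum_subset_closure_cellSign σ hxσ
  have hxflat : ∀ j ∈ D.flat σ, D.gap j x = 0 := fun j hj =>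
    D.gap_eq_zero_of_mem_closure hxσ (D.mem_flat.1 hj)
  set z₀ : ℝ × Pt d := (t, x) with hz₀
  have hPz₀ : timeProj D σ z₀ = z₀ := by
    rw [timeProj, hz₀, D.proj_eq_self hxflat]
  set g : ℝ × Pt d → ℝ := fun z => φ (timeProj D σ z) + sqDist z₀ z with hgdef
  set γ : ℝ × Pt d → (ℝ × Pt d →L[ℝ] ℝ) := fun z =>
    (δ (timeProj D σ z)).comp (timeProjLin D σ) + fderiv ℝ (sqDist z₀) z with hγdef
  have hgγ : HasExtDiff T (D.stratum τ) g γ :=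
    (hδ.comp_timeProj hne).add_smooth
      (fun z => ((contDiff_sqDist z₀).differentiable one_ne_zero z).hasFDerivAt)
      ((contDiff_sqDist z₀).continuous_fderiv one_ne_zero)
  have hgnγ : ∀ n : ℕ, HasExtDiff T (D.stratum τ) (fun z => g z + n * flatPenalty D σ z)
      (fun z => γ z + (n : ℝ) • flatPenaltyDeriv D σ z) := fun n =>
    hgγ.add_smooth (fun z => (hasFDerivAt_flatPenalty D σ z).const_mul (n : ℝ))
      ((continuous_flatPenaltyDeriv D σ).const_smul (n : ℝ))
  have hgc : ContinuousOn g (Ioo 0 T ×ˢ univ) :=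
    (hφ.comp continuous_timeProj.continuousOn fun z hz => ⟨hz.1, mem_univ _⟩).add
      (contDiff_sqDist z₀).continuous.continuousOn
  have hgnc : ∀ n : ℕ, ContinuousOn (fun z => g z + n * flatPenalty D σ z) (Ioo 0 T ×ˢ univ) :=
    fun n => hgc.add (continuous_const.mul (continuous_flatPenalty D σ)).continuousOn
  obtain ⟨r, hr, hball⟩ := exists_closedBall_subset_strip ht x
    (eventually_nhdsWithin_iff.1 hmax)
  set B : Set (ℝ × Pt d) := Metric.closedBall z₀ r ∩ univ ×ˢ closure (D.stratum τ) with hB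
  have hBU : B ⊆ Ioo 0 T ×ˢ univ := fun z hz => ⟨(hball z hz.1).1, mem_univ _⟩
  have hBI : B ⊆ Icc 0 T ×ˢ univ := hBU.trans (prod_mono_left Ioo_subset_Icc_self)
  have hBc : IsCompact B :=
    (isCompact_closedBall z₀ r).inter_right (isClosed_univ.prod isClosed_closure)
  have hz₀B : z₀ ∈ B := ⟨Metric.mem_closedBall_self hr.le, mem_univ _, hxτ⟩
  have hex : ∀ n, ∃ z ∈ B, IsMaxOn (fun z => un n z + -(g z + n * flatPenalty D σ z)) B z :=
    fun n => UpperSemicontinuousOn.exists_isMaxOn ⟨z₀, hz₀B⟩ hBc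
      (((hun n).1.mono (hBU.trans (prod_mono_left Ioo_subset_Ioc_self))).add
        ((hgnc n).mono hBU).neg.upperSemicontinuousOn)
  choose zn hznB hzn using hex
  have hunif := (tendstoLocallyUniformlyOn_iff_tendstoUniformlyOn_of_compact hBc).1
    (hulim.mono hBI)
  have hznlim : Tendsto zn atTop (𝓝 z₀) := by
    refine tendsto_of_isMaxOn_penalized hBc (w := fun z => u z - g z)
      (wn := fun n z => un n z - g z) ((hu.mono hBI).sub (hgc.mono hBU)) ?_
      (continuous_flatPenalty D σ).continuousOn (fun z _ => flatPenalty_nonneg D σ z) hz₀B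
      (fun z hz hqz hle => ?_) hznB fun n => ?_
    · refine Metric.tendstoUniformlyOn_iff.2 fun ε hε => ?_
      filter_upwards [Metric.tendstoUniformlyOn_iff.1 hunif ε hε] with n hn z hz
      rw [dist_sub_right]; exact hn z hz
    -- Zero penalty means that `z` is fixed by the projection, hence lies over the closed stratum,
    -- where the maximality of `u - φ` applies.
    · apply eq_of_sqDist_nonpos
      have hPz : timeProj D σ z = z := by
        rw [timeProj, D.proj_eq_self ((flatPenalty_eq_zero_iff D).1 hqz)]
      have hzM : z ∈ Ioo 0 T ×ˢ closure (D.stratum σ) := by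
        rw [← hPz]
        exact mapsTo_timeProj_closure hne _ ⟨(hBU hz).1, hz.2.2⟩
      have h1 : u z - φ z ≤ u z₀ - φ z₀ := (hball z hz.1).2 hzM
      have h2 : u z₀ - (φ (timeProj D σ z₀) + sqDist z₀ z₀) ≤
        u z - (φ (timeProj D σ z) + sqDist z₀ z) := hle
      rw [sqDist_self, hPz, hPz₀] at h2
      linarith
    · have h0 : flatPenalty D σ z₀ = 0 := (flatPenalty_eq_zero_iff D).2 hxflat
      have : un n z₀ + -(g z₀ + n * flatPenalty D σ z₀) ≤
        un n (zn n) + -(g (zn n) + n * flatPenalty D σ (zn n)) := hzn n hz₀B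
      rw [h0] at this
      linarith
  have hγlim : Tendsto (fun n => γ (zn n)) atTop (𝓝 (γ z₀)) :=
    (hgγ.1 z₀ ⟨ht, hxτ⟩).tendsto.comp (tendsto_nhdsWithin_iff.2
      ⟨hznlim, Eventually.of_forall fun n => ⟨(hBU (hznB n)).1, (hznB n).2.2⟩⟩)
  have hxlim : Tendsto (fun n => (zn n).2) atTop (𝓝 x) := (continuous_snd.tendsto z₀).comp hznlim
  rw [add_hamSup_nonpos_iff]
  rintro a ⟨ha, -, hav⟩
  by_contra! hpos
  -- The velocity of an essential control is tangent to the stratum, so the projection preserves it.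
  have hγ₀ : γ z₀ (1, f x a) = δ z₀ (1, f x a) := by
    have : timeProjLin D σ (1, f x a) = (1, f x a) := by
      simp only [timeProjLin, ContinuousLinearMap.prod_apply, ContinuousLinearMap.comp_apply,
        ContinuousLinearMap.coe_fst', ContinuousLinearMap.coe_snd']
      rw [D.projLin_eq_self fun j hj =>
        D.inner_eq_zero_of_mem_tangentCone hxσ hav (D.mem_flat.1 hj)]
    simp only [hγdef, fderiv_sqDist_self, add_zero, ContinuousLinearMap.comp_apply, this, hPz₀]
  obtain ⟨η, hη0, hηκ, hη⟩ := exists_pos_abs_apply_sub_lt (γ z₀) ‖f x a‖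
    (κ := (-δ z₀ (1, f x a) - ℓ x a) / 4) (by linarith)
  -- The sign pattern needed will depend on `zn n`, hence on `n`; as there are finitely many
  -- patterns, all are handled at once.
  have hctrl : ∀ᶠ n in atTop, ∀ s : Fin D.q → SignType, (∀ j, s j ≠ 0) →
      (∀ j, σ j ≠ 0 → s j = σ j) → ∃ b ∈ 𝒜, ‖fn n (zn n).2 b - f x a‖ < η ∧
        ℓn n (zn n).2 b < ℓ x a + η ∧
        ∀ j, D.gap j x = 0 → 0 < (s j : ℝ) * inner ℝ (D.normal j) (fn n (zn n).2 b) := by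
    refine eventually_all.2 fun s => ?_
    by_cases hs : (∀ j, s j ≠ 0) ∧ ∀ j, σ j ≠ 0 → s j = σ j
    swap
    · exact Eventually.of_forall fun n h1 h2 => absurd ⟨h1, h2⟩ hs
    obtain ⟨c, hc, hcf, hcl, hcs⟩ := exists_control_strict_side (s := fun j => (s j : ℝ)) hL hG h2
      ha (fun j h0 => by simpa [h0] using MultiDomain.cast_sign_mul_self (hs.1 j))
      (fun j hj => by
        by_cases hσ : σ j = 0
        · rw [D.inner_eq_zero_of_mem_tangentCone hxσ hav hσ, mul_zero]
        · rw [hs.2 j hσ]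
          exact D.sign_mul_inner_nonneg_of_mem_tangentCone hxσ hav hj) (half_pos hη0)
    have hopen : IsOpen {v : Pt d | ∀ j, D.gap j x = 0 →
        0 < (s j : ℝ) * inner ℝ (D.normal j) v} := by
      simp only [ofPred_forall]
      exact isOpen_iInter_of_finite fun j => isOpen_iInter_of_finite fun _ =>
        isOpen_lt continuous_const (by fun_prop)
    -- Velocities within `ρ` of `f x c` keep the strict side conditions, so these pass to `fn n`.
    obtain ⟨ρ, hρ, hρs⟩ := Metric.isOpen_iff.1 hopen _ hcs
    filter_upwards [eventually_exists_control_of_tendsto h𝒜 hGLip hL hfn hℓn hxlim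
      (lt_min (half_pos hη0) hρ)] with n hn _ _
    obtain ⟨b, hb, hbf, hbl⟩ := hn.1 c hc
    rw [lt_min_iff] at hbf
    refine ⟨b, hb, ?_, by linarith [min_le_left (η / 2) ρ], hρs (mem_ball_iff_norm.2 hbf.2)⟩
    linarith [norm_sub_le_norm_sub_add_norm_sub (fn n (zn n).2 b) (f x c) (f x a)]
  have hactive : ∀ᶠ n in atTop, ∀ j, D.gap j (zn n).2 = 0 → D.gap j x = 0 := by
    refine eventually_all.2 fun j => ?_
    by_cases hj : D.gap j x = 0
    · exact Eventually.of_forall fun _ _ => hj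
    · filter_upwards [(((D.continuous_gap j).tendsto x).comp hxlim).eventually_ne hj] with n hn h
      exact absurd h hn
  obtain ⟨n, hnb, hnγ, hnc, hna⟩ := ((hznlim.eventually (Metric.ball_mem_nhds z₀ hr)).and
    ((Metric.tendsto_nhds.1 hγlim η hη0).and (hctrl.and hactive))).exists
  have hloc : IsLocalMaxOn (fun z => un n z - (g z + n * flatPenalty D σ z))
      (Ioo 0 T ×ˢ closure (D.stratum τ)) (zn n) := by
    filter_upwards [mem_nhdsWithin_of_mem_nhds (Metric.isOpen_ball.mem_nhds hnb),
      self_mem_nhdsWithin] with z hz hzS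
    have : un n z + -(g z + n * flatPenalty D σ z) ≤
        un n (zn n) + -(g (zn n) + n * flatPenalty D σ (zn n)) :=
      hzn n ⟨Metric.ball_subset_closedBall hz, mem_univ _, hzS.2⟩
    linarith
  have hznτ : (zn n).2 ∈ closure (D.stratum τ) := (hznB n).2.2
  have hsub := (hun n).2 (zn n).1 (zn n).2 (hBU (hznB n)).1 τ hznτ _ _ (hgnc n) (hgnγ n) hloc
  rw [add_hamSup_nonpos_iff] at hsub
  obtain ⟨b, hb, hbf, hbl, hbs⟩ := hnc
    -- The cell is on the positive side of the hyperplanes containing `σ`. The velocity points into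
    -- it where `zn n` is on such a hyperplane, and back towards the hyperplane where the gap is
    -- positive. The first choice makes the control essential on the cell, the second makes the
    -- penalty decrease.
    (fun j => if σ j = 0 then (if D.gap j (zn n).2 = 0 then 1 else -1) else σ j)
    (fun j => by
      by_cases hσ : σ j = 0
      · by_cases hj : D.gap j (zn n).2 = 0 <;> simp [hσ, hj]
      · simp [hσ])
    (fun j hj => if_neg hj)
  have hbE : b ∈ essCtrlOn 𝒜 (fn n) (D.stratum τ) (zn n).2 := by
    refine (hFn n).mem_essCtrlOn_cell hτ hznτ hb fun j hj => ?_
    have := (hbs j (hna j hj)).le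
    by_cases hσ : σ j = 0
    · simpa [hσ, hj, hτdef, MultiDomain.cellSign] using this
    · simpa [hσ, hτdef, MultiDomain.cellSign] using this
  have hpen : flatPenaltyDeriv D σ (zn n) (1, fn n (zn n).2 b) ≤ 0 := by
    rw [flatPenaltyDeriv_apply]
    refine Finset.sum_nonpos fun j hj => ?_
    have hσ := D.mem_flat.1 hj
    by_cases hj0 : D.gap j (zn n).2 = 0
    · simp [hj0]
    · have h1 := hbs j (hxflat j hj)
      have h3 := D.sign_mul_gap_nonneg hznτ j
      simp only [hσ, hj0, if_true, if_false, SignType.coe_neg_one, neg_one_mul] at h1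
      simp only [hσ, hτdef, MultiDomain.cellSign, if_true, SignType.coe_one, one_mul] at h3
      exact mul_nonpos_of_nonneg_of_nonpos (by linarith) (by linarith)
  have hval := hsub b hbE
  simp only [Prod.mk.eta, add_apply, smul_apply, smul_eq_mul] at hval
  rw [dist_eq_norm] at hnγ
  have hclose := abs_lt.1 (hη _ _ _ hnγ le_rfl hbf)
  rw [hγ₀] at hclose
  -- Only the sign of the penalty term is used, so the factor `n` needs no bound.
  have := mul_nonpos_of_nonneg_of_nonpos (Nat.cast_nonneg (α := ℝ) n) hpen
  linarith

end Stability

end HJB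

theorem mainTheorem11 {d N : ℕ} (D : MultiDomain d) (𝒜 : Set (Pt N)) (h𝒜 : IsCompact 𝒜)
    (T : ℝ) (hT : 0 < T)
    (f : Pt d → Pt N → Pt d) (ℓ : Pt d → Pt N → ℝ)
    (cf cl lam : ℝ) (KF KL : ℝ → ℝ≥0)
    (hF : HF D 𝒜 f cf KF) (hL : HL D 𝒜 ℓ cl lam KL)
    (hG : HG 𝒜 f ℓ cl lam) (hGLip : AugLipschitz D 𝒜 f ℓ cl lam) (h2 : H2 D 𝒜 f)
    (fn : ℕ → Pt d → Pt N → Pt d) (ℓn : ℕ → Pt d → Pt N → ℝ)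
    (cf' cl' lam' : ℝ) (KF' KL' : ℝ → ℝ≥0)
    (hFn : ∀ n, HF D 𝒜 (fn n) cf' KF') (hLn : ∀ n, HL D 𝒜 (ℓn n) cl' lam' KL')
    (hfn : TendstoLocallyUniformlyOn (fun n (z : Pt d × Pt N) => fn n z.1 z.2)
      (fun z => f z.1 z.2) atTop (univ ×ˢ 𝒜))
    (hℓn : TendstoLocallyUniformlyOn (fun n (z : Pt d × Pt N) => ℓn n z.1 z.2)
      (fun z => ℓ z.1 z.2) atTop (univ ×ˢ 𝒜))
    (φ : Pt d → ℝ) (hφ : ∃ K, LipschitzWith K φ)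
    (φn : ℕ → Pt d → ℝ) (hφn : ∀ n, ∃ K, LipschitzWith K (φn n))
    (hφlim : TendstoLocallyUniformly φn φ atTop)
    (un : ℕ → ℝ × Pt d → ℝ) (u : ℝ × Pt d → ℝ)
    (hun : ∀ n, IsSolution D 𝒜 (fn n) (ℓn n) T (φn n) (un n))
    (hunLip : ∀ n, LocallyLipschitzOn (Icc 0 T ×ˢ D.interface) (un n))
    (hulim : TendstoLocallyUniformlyOn un u atTop (Icc 0 T ×ˢ univ))
    (hu : ContinuousOn u (Icc 0 T ×ˢ univ)) :
    IsSolution D 𝒜 f ℓ T φ u := by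
  refine ⟨isSupersolution_of_tendsto h𝒜 hF hL hGLip hfn hℓn hFn (fun n => (hun n).1) hulim hu,
    isSubsolution_of_tendsto h𝒜 hL hG hGLip h2 hfn hℓn hFn (fun n => (hun n).2.1) hulim hu,
    fun x => ?_⟩
  have h1 : Tendsto (fun n => un n (T, x)) atTop (𝓝 (u (T, x))) :=
    hulim.tendsto_at ⟨right_mem_Icc.2 hT.le, mem_univ _⟩
  simp only [fun n => (hun n).2.2 x] at h1
  exact tendsto_nhds_unique h1
    ((tendstoLocallyUniformlyOn_univ.2 hφlim).tendsto_at (mem_univ x))
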